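/- Let $n,p\ge 0$ be integers, $A_{-1}\in\mathbb R^{n\times n}$, let $A_2,A_3:[-1,0]\to\mathbb R^{n\times n}$ have entries in $L_2(-1,0)$, $C\in\mathbb R^{p\times n}$ and $T>0$. In the Hilbert space $M_2=\mathbb R^n\times L_2(-1,0;\mathbb R^n)$ consider the operator $\mathcal A$ of the neutral type system $$\dot z(t)=A_{-1}\dot z(t-1)+\int_{-1}^0\big[A_2(\theta)\dot z(t+\theta)+A_3(\theta)z(t+\theta)\big]\,d\theta ,$$ $$D(\mathcal A)=\{(v,\varphi):\varphi\in H^1([-1,0];\mathbb R^n),\ v=\varphi(0)-A_{-1}\varphi(-1)\},\qquad \mathcal A(v,\varphi)=\Big(\int_{-1}^0 [A_2(\theta)\varphi'(\theta)+A_3(\theta)\varphi(\theta)]\,d\theta,\ \varphi'\Big),$$ and let $\mathcal A^\dagger$ be the operator defined in the same way with the transposed matrices $A_{-1}^*,A_2^*(\theta),A_3^*(\theta)$, which corresponds to the transposed controlled system $$\dot z(t)=A_{-1}^*\dot z(t-1)+\int_{-1}^0\big[A_2^*(\theta)\dot z(t+\theta)+A_3^*(\theta)z(t+\theta)\big]\,d\theta+C^*u(t).$$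 Then $\mathcal A$ and $\mathcal A^\dagger$ are the infinitesimal generators of $C_0$-semigroups $e^{\mathcal At}$ and $e^{\mathcal A^\dagger t}$ on $M_2$, and the following holds. For an output operator $\mathcal C:D(\mathcal A)\to\mathbb R^p$ let $\mathcal K$ be the operator $x_0\mapsto \mathcal C e^{\mathcal A\,\cdot}x_0\in L_2(0,T;\mathbb R^p)$ with domain $D(\mathcal A)$; the observed system is called approximately observable on $[0,T]$ if $\ker\mathcal K=\{0\}$, that is, if $x_0\in D(\mathcal A)$ and $\mathcal Ce^{\mathcal At}x_0=0$ for almost all $t\in[0,T]$ imply $x_0=0$. The transposed system is called approximately controllable at time $T$ if its reachable set $$R_T^\dagger=\Big\{\int_0^T e^{\mathcal A^\dagger t}\begin{pmatrix}C^*u(t)\\0\end{pmatrix}dt:\ u\in L_2(0,T;\mathbb R^p)\Big\}$$ is dense in $M_2$. 1. The system with the output $y(t)=Cz(t-1)$, i.e. $\mathcal C(v,\varphi)=C\varphi(-1)$, is approximately observable on $[0,T]$ if and only if the transposed system is approximately controllable at time $T$. 2. If $\det A_{-1}\neq0$, the same equivalence, with the same $T$, holds for the output $y(t)=Cz(t)$,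 i.e. $\mathcal C(v,\varphi)=C\varphi(0)$. -/

import Mathlib

open MeasureTheory Filter Topology

noncomputable section

namespace NeutralSystem

/-- The Euclidean space `ℝⁿ`. -/
abbrev Vec (n : ℕ) : Type := EuclideanSpace ℝ (Fin n)

/-- Lebesgue measure on the interval `[a, b]`. -/
abbrev lebesgueOn (a b : ℝ) : Measure ℝ := volume.restrict (Set.Icc a b)

/-- The space `L₂(a, b; ℝⁿ)`. -/
abbrev L2 (a b : ℝ) (n : ℕ) : Type := Lp (Vec n) 2 (lebesgueOn a b)

/-- The Hilbert space `M₂ = ℝⁿ × L₂(-1, 0; ℝⁿ)`. -/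
abbrev M2 (n : ℕ) : Type := WithLp 2 (Vec n × L2 (-1) 0 n)

/-- The product of a matrix with a vector. -/
abbrev act {m n : ℕ} (A : Matrix (Fin m) (Fin n) ℝ) (v : Vec n) : Vec m :=
  Matrix.toEuclideanLin A v

/-- `φ` belongs to `H¹([-1, 0]; ℝⁿ)` and has the (weak) derivative `g ∈ L₂(-1, 0; ℝⁿ)`: on
`[-1, 0]` the function `φ` is a primitive of `g`. In particular `φ` is the continuous
representative. Its values outside `[-1, 0]` are irrelevant. -/
def IsH1 {n : ℕ} (φ : ℝ → Vec n) (g : L2 (-1) 0 n) : Prop :=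
  ∀ θ ∈ Set.Icc (-1 : ℝ) 0, φ θ = φ 0 + ∫ s in (0 : ℝ)..θ, g s

/-- The operator `L φ = ∫_{-1}^0 (A₂(θ) φ'(θ) + A₃(θ) φ(θ)) dθ`, where `g` is the derivative of
`φ`. -/
def delayOp {n : ℕ} (A₂ A₃ : ℝ → Matrix (Fin n) (Fin n) ℝ) (φ : ℝ → Vec n)
    (g : L2 (-1) 0 n) : Vec n :=
  ∫ θ in Set.Icc (-1 : ℝ) 0, (act (A₂ θ) (g θ) + act (A₃ θ) (φ θ))

/-- The graph of the operator `𝒜` in `M₂` of the neutral type system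
`ż(t) = A₁ ż(t-1) + ∫_{-1}^0 (A₂(θ) ż(t+θ) + A₃(θ) z(t+θ)) dθ`
(with `A₁` in the place of `A_{-1}`): the domain consists of the pairs `(v, φ)` with `φ ∈ H¹` and
`v = φ(0) - A₁ φ(-1)`, and `𝒜 (v, φ) = (L φ, φ')`. -/
def generatorGraph {n : ℕ} (A₁ : Matrix (Fin n) (Fin n) ℝ)
    (A₂ A₃ : ℝ → Matrix (Fin n) (Fin n) ℝ) : Set (M2 n × M2 n) :=
  {xy | ∃ φ : ℝ → Vec n, ∃ g : L2 (-1) 0 n, IsH1 φ g ∧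
    (⇑xy.1.snd =ᵐ[lebesgueOn (-1) 0] φ) ∧ xy.1.fst = φ 0 - act A₁ (φ (-1)) ∧
    xy.2 = WithLp.toLp 2 (delayOp A₂ A₃ φ g, g)}

/-- The domain `D(𝒜)`. -/
def domain {n : ℕ} (A₁ : Matrix (Fin n) (Fin n) ℝ) : Set (M2 n) :=
  {x | ∃ φ : ℝ → Vec n, ∃ g : L2 (-1) 0 n, IsH1 φ g ∧
    (⇑x.snd =ᵐ[lebesgueOn (-1) 0] φ) ∧ x.fst = φ 0 - act A₁ (φ (-1))}

/-- `S(t)`, `t ≥ 0`, is a `C₀`-semigroup of bounded operators (values at `t < 0` are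
irrelevant). -/
structure IsC0Semigroup {X : Type*} [NormedAddCommGroup X] [NormedSpace ℝ X]
    (S : ℝ → X →L[ℝ] X) : Prop where
  zero : S 0 = ContinuousLinearMap.id ℝ X
  add : ∀ s t, 0 ≤ s → 0 ≤ t → S (s + t) = (S s).comp (S t)
  strong : ∀ x, Tendsto (fun t => S t x) (𝓝[>] 0) (𝓝 x)

/-- `S` is a `C₀`-semigroup and `G` is the graph of its infinitesimal generator:
`(x, y) ∈ G` if and only if `(S(t) x - x) / t → y` as `t → 0+`. -/
def IsGeneratedBy {X : Type*} [NormedAddCommGroup X] [NormedSpace ℝ X]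
    (S : ℝ → X →L[ℝ] X) (G : Set (X × X)) : Prop :=
  IsC0Semigroup S ∧
    ∀ x y, (x, y) ∈ G ↔ Tendsto (fun t : ℝ => t⁻¹ • (S t x - x)) (𝓝[>] 0) (𝓝 y)

theorem IsH1.continuousOn {n : ℕ} {φ : ℝ → Vec n} {g : L2 (-1) 0 n} (h : IsH1 φ g) :
    ContinuousOn φ (Set.Icc (-1) 0) := by
  have hg : IntegrableOn (⇑g) (Set.uIcc (-1 : ℝ) 0) := by
    rw [Set.uIcc_of_le (by norm_num)]
    exact (Lp.memLp g).integrable (by norm_num)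
  have h1 := intervalIntegral.continuousOn_primitive_interval' (a := (0 : ℝ))
    (hg.intervalIntegrable) (by simp)
  rw [Set.uIcc_of_le (by norm_num)] at h1
  exact (continuousOn_const.add h1).congr h

/-- An element of `L₂(-1, 0; ℝⁿ)` has at most one continuous representative on `[-1, 0]`. -/
theorem IsH1.eqOn {n : ℕ} {φ ψ : ℝ → Vec n} {g k : L2 (-1) 0 n} (hφ : IsH1 φ g)
    (hψ : IsH1 ψ k) (h : φ =ᵐ[lebesgueOn (-1) 0] ψ) : Set.EqOn φ ψ (Set.Icc (-1) 0) :=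
  Measure.eqOn_Icc_of_ae_eq volume (by norm_num) h hφ.continuousOn hψ.continuousOn

open Classical in
/-- The value `f(θ)`, `θ ∈ [-1, 0]`, of an element `f` of `H¹([-1, 0]; ℝⁿ) ⊆ L₂(-1, 0; ℝⁿ)`,
that is, of its continuous representative (and `0` if `f` is not in `H¹`). -/
def pointValue {n : ℕ} (f : L2 (-1) 0 n) (θ : ℝ) : Vec n :=
  if h : ∃ φ : ℝ → Vec n, (∃ g, IsH1 φ g) ∧ ⇑f =ᵐ[lebesgueOn (-1) 0] φ then h.choose θ else 0

theorem pointValue_eq {n : ℕ} {f : L2 (-1) 0 n} {φ : ℝ → Vec n} {g : L2 (-1) 0 n}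
    (hφ : IsH1 φ g) (hf : ⇑f =ᵐ[lebesgueOn (-1) 0] φ) {θ : ℝ} (hθ : θ ∈ Set.Icc (-1) 0) :
    pointValue f θ = φ θ := by
  have h : ∃ φ : ℝ → Vec n, (∃ g, IsH1 φ g) ∧ ⇑f =ᵐ[lebesgueOn (-1) 0] φ := ⟨φ, ⟨g, hφ⟩, hf⟩
  obtain ⟨⟨k, hk⟩, hc⟩ := h.choose_spec
  rw [pointValue, dif_pos h]
  exact hk.eqOn hφ (hc.symm.trans hf) hθ

/-- The output operator `x = (v, φ) ↦ C φ(θ₀)` on `D(𝒜)`. Along a trajectory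
`x(t) = (v(t), z_t)`, `z_t(θ) = z(t + θ)`, the choice `θ₀ = 0` gives the output `C z(t)` and
`θ₀ = -1` gives the output `C z(t - 1)`. -/
def output {n p : ℕ} (C : Matrix (Fin p) (Fin n) ℝ) (θ₀ : ℝ) (x : M2 n) : Vec p :=
  act C (pointValue x.snd θ₀)

/-- The kernel of the operator `𝒦 : x₀ ↦ 𝒞 S(·) x₀ ∈ L₂(0, T; ℝᵖ)`, where `𝒞` is the output operator
`output C θ₀`; since `𝒞` is defined on `D(𝒜)` only, so is `𝒦`. -/
def outputKernel {n p : ℕ} (A₁ : Matrix (Fin n) (Fin n) ℝ) (S : ℝ → M2 n →L[ℝ] M2 n)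
    (C : Matrix (Fin p) (Fin n) ℝ) (θ₀ T : ℝ) : Set (M2 n) :=
  {x₀ | x₀ ∈ domain A₁ ∧ ∀ᵐ t ∂(lebesgueOn 0 T), output C θ₀ (S t x₀) = 0}

/-- Approximate observability on `[0, T]`: `ker 𝒦 = {0}`. -/
def ApproxObservable {n p : ℕ} (A₁ : Matrix (Fin n) (Fin n) ℝ) (S : ℝ → M2 n →L[ℝ] M2 n)
    (C : Matrix (Fin p) (Fin n) ℝ) (θ₀ T : ℝ) : Prop :=
  outputKernel A₁ S C θ₀ T = {0}

/-- The reachable set `{∫₀ᵀ S(t) (B u(t), 0) dt : u ∈ L₂(0, T; ℝᵐ)}`. -/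
def reachableSet {n m : ℕ} (S : ℝ → M2 n →L[ℝ] M2 n) (B : Matrix (Fin n) (Fin m) ℝ) (T : ℝ) :
    Set (M2 n) :=
  Set.range fun u : L2 0 T m =>
    ∫ t in Set.Icc (0 : ℝ) T, S t (WithLp.toLp 2 (act B (u t), (0 : L2 (-1) 0 n)))

/-- Approximate controllability at time `T`: the reachable set is dense in `M₂`. -/
def ApproxControllable {n m : ℕ} (S : ℝ → M2 n →L[ℝ] M2 n) (B : Matrix (Fin n) (Fin m) ℝ)
    (T : ℝ) : Prop :=
  closure (reachableSet S B T) = Set.univ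

end NeutralSystem

end

/-! An element of `D(𝒜)` is described by the coordinates `e = (φ(0), φ')` in `M₂`, which run over
the whole space. In them the inclusion of `D(𝒜)` and the operator `𝒜` become the bounded maps
`embed` and `action`.

The equivalence is a duality between `𝒜` and the adjoint of `𝒜†`. It rests on a bounded bijection
`W` of `M₂`, applied to the coordinates, with two properties. It intertwines: if `𝒜` maps the state
of `e` to the state of `e₁`, then `⟪𝒜† x', W e⟫ = ⟪x', W e₁⟫` for `x'` in `D(𝒜†)`. And the first
component of `W e` is `φ(θ₀)`, the quantity that is observed through `C`. The intertwining passes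
from generators to semigroups (`IsGeneratedBy.intertwine`, `inner_semigroup`) and gives
`⟪e^{𝒜†t}(C*u, 0), W e⟫ = ⟪u, C φ_t(θ₀)⟫`, where `φ_t` is the history at time `t` of the trajectory
starting at `e`. Hence `W e` is orthogonal to the reachable set exactly when the output of `e`
vanishes, and bijectivity of `W` turns this into the theorem (`approxObservable_iff`).

To find `W`, note that `(b, f)` is in the domain of `(𝒜†)*` if `r = f + A₂ b` is in `H¹` and `r(-1)
= A₁ r(0)`; its image is then `(r(0), A₃ b - r')` (`inner_action_eq_inner_embed`). For `θ₀ = -1` one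
reverses time and corrects by convolutions with `A₂` and `A₃`, chosen so that the condition at `-1`
becomes the equation for the first component of the state. The second component of `W` is then an
identity plus Volterra operators, always invertible (`bijective_volterra`). For `θ₀ = 0` the leading
term is `A₁ φ'` instead, whence the condition on the determinant.

Generation comes from the Lumer–Phillips theorem in an equivalent inner product. The similarity
`weight` removes the term `∫ A₂ φ'`, and an exponential weight makes the boundary term at `-1`
strong enough to absorb `A₁ φ(-1)` (`exists_quasidissipative`). The range condition reduces to a
linear equation in `ℝⁿ` (`surjective_resolvent`). -/

open scoped RealInnerProductSpace ENNReal

noncomputable section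

namespace NeutralSystem

/-! ### Semigroups and the intertwining of two of them by a bilinear form. -/

section Semigroups

variable {X Y : Type*} [NormedAddCommGroup X] [NormedSpace ℝ X] [NormedAddCommGroup Y]
  [NormedSpace ℝ Y] {S : ℝ → X →L[ℝ] X} {S' : ℝ → Y →L[ℝ] Y} {G : Set (X × X)}
  {G' : Set (Y × Y)}

theorem IsC0Semigroup.tendsto_Ici (hS : IsC0Semigroup S) (x : X) :
    Tendsto (fun t => S t x) (𝓝[≥] 0) (𝓝 x) := by
  have h : ContinuousWithinAt (fun t => S t x) (Set.Ioi 0) 0 := by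
    have := hS.strong x
    rw [ContinuousWithinAt, hS.zero]
    simpa using this
  have h2 := continuousWithinAt_Ioi_iff_Ici.1 h
  rw [ContinuousWithinAt, hS.zero] at h2
  simpa using h2

/-- Otherwise there are times `t k → 0` with `‖S (t k)‖ > k + 1`, although `S (t k) x` converges for
every `x`; this contradicts uniform boundedness. -/
theorem IsC0Semigroup.exists_bound_near_zero [CompleteSpace X] (hS : IsC0Semigroup S) :
    ∃ M : ℝ, 1 ≤ M ∧ ∃ δ > 0, ∀ t ∈ Set.Icc (0 : ℝ) δ, ‖S t‖ ≤ M := by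
  by_contra! H
  have H' : ∀ k : ℕ, ∃ t ∈ Set.Icc (0 : ℝ) (1 / (k + 1)), (k : ℝ) + 1 < ‖S t‖ := fun k =>
    H (k + 1) (by simp) _ (by positivity)
  choose t ht hk using H'
  have ht0 : Tendsto t atTop (𝓝[≥] 0) := by
    refine tendsto_nhdsWithin_iff.2 ⟨?_, Eventually.of_forall fun k => (ht k).1⟩
    exact squeeze_zero (fun k => (ht k).1) (fun k => (ht k).2)
      tendsto_one_div_add_atTop_nhds_zero_nat
  obtain ⟨C, hC⟩ := banach_steinhaus (g := fun k => S (t k)) fun x => by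
    have h1 := ((hS.tendsto_Ici x).comp ht0).norm
    obtain ⟨C, hC⟩ := h1.bddAbove_range
    exact ⟨C, fun i => hC ⟨i, rfl⟩⟩
  obtain ⟨k, hkC⟩ := exists_nat_gt C
  linarith [hC k, hk k]

theorem IsC0Semigroup.exists_bound [CompleteSpace X] (hS : IsC0Semigroup S) (T : ℝ) :
    ∃ M : ℝ, 0 ≤ M ∧ ∀ t ∈ Set.Icc (0 : ℝ) T, ‖S t‖ ≤ M := by
  obtain ⟨M, hM, δ, hδ, h⟩ := hS.exists_bound_near_zero
  have key : ∀ k : ℕ, ∀ t ∈ Set.Icc (0 : ℝ) (k * δ), ‖S t‖ ≤ M ^ (k + 1) := by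
    intro k
    induction k with
    | zero =>
      intro t ht
      simpa using h t ⟨ht.1, by have := ht.2; simp at this; linarith⟩
    | succ k ih =>
      intro t ht
      rcases le_total t δ with h1 | h1
      · exact (h t ⟨ht.1, h1⟩).trans (le_self_pow₀ hM (by omega))
      · have h2 := ih (t - δ) ⟨by linarith, by have := ht.2; push_cast at this; linarith⟩
        have h3 : S t = (S δ).comp (S (t - δ)) := by
          rw [← hS.add δ (t - δ) hδ.le (by linarith)]; congr 1; ring
        rw [h3, pow_succ']
        exact (ContinuousLinearMap.opNorm_comp_le _ _).trans
          (mul_le_mul (h δ ⟨hδ.le, le_rfl⟩) h2 (norm_nonneg _) (by linarith))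
  obtain ⟨k, hk⟩ := exists_nat_gt (T / δ)
  refine ⟨M ^ (k + 1), by positivity, fun t ht => key k t ⟨ht.1, ht.2.trans ?_⟩⟩
  rw [div_lt_iff₀ hδ] at hk
  exact hk.le

/-- For `a ≤ b` one has `S b x - S a x = S a (S (b - a) x - x)`, so the local bound carries
continuity at `0` to both sides of every `t`. -/
theorem IsC0Semigroup.continuousOn [CompleteSpace X] (hS : IsC0Semigroup S) (x : X) :
    ContinuousOn (fun t => S t x) (Set.Ici 0) := by
  intro t ht
  obtain ⟨M, hM0, hM⟩ := hS.exists_bound (t + 1)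
  have key : ∀ a b : ℝ, 0 ≤ a → a ≤ b → b ≤ t + 1 → ‖S b x - S a x‖ ≤ M * ‖S (b - a) x - x‖ := by
    intro a b ha hab hb
    have h1 : S b x = S a (S (b - a) x) := by
      rw [← ContinuousLinearMap.comp_apply, ← hS.add a (b - a) ha (by linarith)]
      congr 2; ring
    rw [h1, ← map_sub]
    exact (S a).le_of_opNorm_le (hM a ⟨ha, hab.trans hb⟩) _
  have h2 : Tendsto (fun s => M * ‖S |s - t| x - x‖) (𝓝[Set.Ici 0] t) (𝓝 0) := by
    have : Tendsto (fun s : ℝ => |s - t|) (𝓝[Set.Ici 0] t) (𝓝[≥] 0) := by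
      refine tendsto_nhdsWithin_iff.2 ⟨?_, Eventually.of_forall fun k => Set.mem_Ici.2 (abs_nonneg _)⟩
      have : Continuous fun s : ℝ => |s - t| := by fun_prop
      simpa using (this.tendsto t).mono_left nhdsWithin_le_nhds
    have h3 := ((((hS.tendsto_Ici x).comp this).sub_const x).norm.const_mul M)
    simpa only [sub_self, norm_zero, mul_zero, Function.comp_def] using h3
  rw [ContinuousWithinAt, tendsto_iff_norm_sub_tendsto_zero]
  refine squeeze_zero' (Eventually.of_forall fun s => norm_nonneg _) ?_ h2
  have h5 : ∀ᶠ s in 𝓝[Set.Ici 0] t, s < t + 1 :=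
    mem_nhdsWithin_of_mem_nhds (Iio_mem_nhds (by linarith))
  filter_upwards [self_mem_nhdsWithin, h5] with s hs hs1
  rcases le_total s t with h | h
  · rw [abs_of_nonpos (by linarith), norm_sub_rev, neg_sub]
    exact key s t hs h (by linarith)
  · rw [abs_of_nonneg (by linarith)]
    exact key t s ht h hs1.le

theorem IsGeneratedBy.orbit_mem (hS : IsGeneratedBy S G) {x y : X} (h : (x, y) ∈ G) {t : ℝ}
    (ht : 0 ≤ t) : (S t x, S t y) ∈ G := by
  rw [hS.2] at h ⊢
  have h1 := ((S t).continuous.tendsto _).comp h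
  refine h1.congr' ?_
  filter_upwards [self_mem_nhdsWithin] with s hs
  have h2 : S s (S t x) = S t (S s x) := by
    rw [← ContinuousLinearMap.comp_apply, ← ContinuousLinearMap.comp_apply,
      ← hS.1.add s t (le_of_lt hs) ht, ← hS.1.add t s ht (le_of_lt hs), add_comm]
  simp [h2]

/-- The local bound upgrades strong continuity to joint continuity; the difference quotients below
move time and vector at once. -/
theorem IsC0Semigroup.tendsto_apply [CompleteSpace X] (hS : IsC0Semigroup S) {α : Type*}
    {l : Filter α} {τ : α → ℝ} {f : α → X} {t : ℝ} {x : X} (ht : Tendsto τ l (𝓝 t))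
    (hτ : ∀ᶠ a in l, 0 ≤ τ a) (h0 : 0 ≤ t) (hf : Tendsto f l (𝓝 x)) :
    Tendsto (fun a => S (τ a) (f a)) l (𝓝 (S t x)) := by
  obtain ⟨M, hM0, hM⟩ := hS.exists_bound (t + 1)
  have h1 : Tendsto (fun a => S (τ a) x) l (𝓝 (S t x)) :=
    (hS.continuousOn x t h0).tendsto.comp (tendsto_nhdsWithin_iff.2 ⟨ht, hτ⟩)
  have h2 : Tendsto (fun a => S (τ a) (f a - x)) l (𝓝 0) := by
    have h3 : Tendsto (fun a => M * ‖f a - x‖) l (𝓝 0) := by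
      simpa using ((hf.sub_const x).norm.const_mul M)
    refine squeeze_zero_norm' ?_ h3
    filter_upwards [hτ, ht.eventually (Iio_mem_nhds (lt_add_one t))] with a ha ha1
    exact (S (τ a)).le_of_opNorm_le (hM _ ⟨ha, le_of_lt ha1⟩) _
  simpa using h2.add h1

/-- If a bounded bilinear form intertwines the generators, it intertwines the semigroups. -/
theorem IsGeneratedBy.intertwine_of_mem [CompleteSpace X] [CompleteSpace Y]
    (hS : IsGeneratedBy S G) (hS' : IsGeneratedBy S' G') (b : Y →L[ℝ] X →L[ℝ] ℝ)
    (hb : ∀ x y x' y', (x, y) ∈ G → (x', y') ∈ G' → b y' x = b x' y)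
    {x y : X} {x' y' : Y} (hx : (x, y) ∈ G) (hx' : (x', y') ∈ G') {t : ℝ} (ht : 0 ≤ t) :
    b (S' t x') x = b x' (S t x) := by
  -- This function joins the two sides of the claim. Its right derivative is `b (S' (t - s) x') (S s
  -- y) - b (S' (t - s) y') (S s x)`, which vanishes because orbits stay in the graphs. The
  -- generator only provides right derivatives, hence the separate proof of continuity.
  have hcont : ContinuousOn (fun s => b (S' (t - s) x') (S s x)) (Set.Icc 0 t) := by
    have h1 : ContinuousOn (fun s => S' (t - s) x') (Set.Icc 0 t) :=
      (hS'.1.continuousOn x').comp (by fun_prop) fun s hs => by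
        simpa using hs.2
    have h2 : ContinuousOn (fun s => S s x) (Set.Icc 0 t) :=
      (hS.1.continuousOn x).mono Set.Icc_subset_Ici_self
    exact (b.continuous.comp_continuousOn h1).clm_apply h2
  have hder : ∀ s ∈ Set.Ico 0 t,
      HasDerivWithinAt (fun s => b (S' (t - s) x') (S s x)) 0 (Set.Ici s) s := by
    intro s hs
    rw [← hasDerivWithinAt_Ioi_iff_Ici, hasDerivWithinAt_iff_tendsto_slope' (by simp)]
    have hτ : Tendsto (fun r : ℝ => r - s) (𝓝[>] s) (𝓝[>] 0) := by
      refine tendsto_nhdsWithin_iff.2 ⟨?_, ?_⟩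
      · have : Continuous fun r : ℝ => r - s := by fun_prop
        simpa using (this.tendsto s).mono_left nhdsWithin_le_nhds
      · filter_upwards [self_mem_nhdsWithin] with r hr
        simpa using hr
    have hr0 : ∀ᶠ r in 𝓝[>] s, 0 ≤ t - r := by
      filter_upwards [mem_nhdsWithin_of_mem_nhds (Iio_mem_nhds hs.2)] with r hr
      simpa using le_of_lt hr
    have hrt : Tendsto (fun r : ℝ => t - r) (𝓝[>] s) (𝓝 (t - s)) := by
      have : Continuous fun r : ℝ => t - r := by fun_prop
      exact (this.tendsto s).mono_left nhdsWithin_le_nhds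
    have hts : 0 ≤ t - s := by linarith [hs.2]
    have q1 := ((hS.2 x y).1 hx).comp hτ
    have q2 := ((hS'.2 x' y').1 hx').comp hτ
    have a1 := hS'.1.tendsto_apply hrt hr0 hts (tendsto_const_nhds (x := x'))
    have a2 := hS'.1.tendsto_apply hrt hr0 hts q2
    have a3 := ((S s).continuous.tendsto _).comp q1
    have l1 := ((b.continuous₂.tendsto _).comp (a1.prodMk_nhds a3)).sub
      ((b.continuous₂.tendsto _).comp (a2.prodMk_nhds (tendsto_const_nhds (x := S s x))))
    have e0 : b (S' (t - s) x') (S s y) - b (S' (t - s) y') (S s x) = 0 := by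
      rw [sub_eq_zero]
      exact (hb _ _ _ _ (hS.orbit_mem hx hs.1) (hS'.orbit_mem hx' hts)).symm
    simp only [Function.uncurry_apply_pair] at l1
    rw [e0] at l1
    refine l1.congr' ?_
    filter_upwards [self_mem_nhdsWithin, hr0] with r hr hr1
    have hr : s < r := hr
    have e1 : S r x = S s (S (r - s) x) := by
      rw [← ContinuousLinearMap.comp_apply, ← hS.1.add s (r - s) hs.1 (by linarith)]
      congr 2; ring
    have e2 : S' (t - s) x' = S' (t - r) (S' (r - s) x') := by
      rw [← ContinuousLinearMap.comp_apply, ← hS'.1.add (t - r) (r - s) hr1 (by linarith)]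
      congr 2; ring
    simp only [slope, vsub_eq_sub, Function.comp_apply, Function.uncurry_apply_pair, e1, e2,
      map_smul, map_sub, smul_eq_mul, sub_apply, smul_apply]
    ring
  have := constant_of_has_deriv_right_zero hcont hder t ⟨ht, le_rfl⟩
  simpa [hS.1.zero, hS'.1.zero] using this.symm

theorem IsGeneratedBy.intertwine [CompleteSpace X] [CompleteSpace Y]
    (hS : IsGeneratedBy S G) (hS' : IsGeneratedBy S' G') (b : Y →L[ℝ] X →L[ℝ] ℝ)
    (hb : ∀ x y x' y', (x, y) ∈ G → (x', y') ∈ G' → b y' x = b x' y)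
    (hG : Dense (Prod.fst '' G)) (hG' : Dense (Prod.fst '' G')) (x : X) (x' : Y) {t : ℝ}
    (ht : 0 ≤ t) : b (S' t x') x = b x' (S t x) := by
  have h1 : ∀ x' ∈ Prod.fst '' G', ∀ x, b (S' t x') x = b x' (S t x) := by
    rintro _ ⟨⟨x', y'⟩, hx', rfl⟩ x
    have : (fun x => b (S' t x') x) = fun x => b x' (S t x) := by
      refine Continuous.ext_on hG (by fun_prop) (by fun_prop) ?_
      rintro _ ⟨⟨x, y⟩, hx, rfl⟩
      exact hS.intertwine_of_mem hS' b hb hx hx' ht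
    exact congrFun this x
  have : (fun x' => b (S' t x') x) = fun x' => b x' (S t x) := by
    refine Continuous.ext_on hG' (by fun_prop) (by fun_prop) fun x' hx' => h1 x' hx' x
  exact congrFun this x'

end Semigroups

/-! ### The Lumer–Phillips theorem by Yosida approximation. -/

section LumerPhillips

variable {X : Type*} [NormedAddCommGroup X] [InnerProductSpace ℝ X] [CompleteSpace X]

open NormedSpace in
-- The derivative of `‖exp (s • B) x‖ ^ 2` is twice the inner product of `B z` and `z` at `z = exp
-- (s • B) x`.
theorem norm_exp_smul_apply_le {B : X →L[ℝ] X} (hB : ∀ x, ⟪B x, x⟫ ≤ 0) {t : ℝ} (ht : 0 ≤ t)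
    (x : X) : ‖exp (t • B) x‖ ≤ ‖x‖ := by
  have hd : ∀ s : ℝ, HasDerivAt (fun s : ℝ => ‖exp (s • B) x‖ ^ 2)
      (2 * ⟪exp (s • B) x, B (exp (s • B) x)⟫) s := fun s => by
    have h1 := (hasDerivAt_exp_smul_const' B s).clm_apply (hasDerivAt_const s x)
    simpa using h1.norm_sq
  have h2 : AntitoneOn (fun s : ℝ => ‖exp (s • B) x‖ ^ 2) (Set.Ici 0) := by
    refine antitoneOn_of_deriv_nonpos (convex_Ici 0) (fun s _ => (hd s).continuousAt.continuousWithinAt)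
      (fun s _ => (hd s).differentiableAt.differentiableWithinAt) fun s _ => ?_
    rw [(hd s).deriv, real_inner_comm]
    linarith [hB (exp (s • B) x)]
  have h3 := h2 (Set.mem_Ici.2 le_rfl) (Set.mem_Ici.2 ht) ht
  simp only [zero_smul, exp_zero, one_apply_eq_self] at h3
  exact le_of_sq_le_sq h3 (norm_nonneg _)

open NormedSpace in
-- Interpolate by `exp (s • B) (exp ((t - s) • B') x)`. Since `B` and `B'` commute, the derivative
-- is the same product of contractions applied to `B x - B' x`.
theorem norm_exp_smul_sub_exp_smul_le {B B' : X →L[ℝ] X} (hB : ∀ x, ⟪B x, x⟫ ≤ 0)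
    (hB' : ∀ x, ⟪B' x, x⟫ ≤ 0) (hc : Commute B B') {t : ℝ} (ht : 0 ≤ t) (x : X) :
    ‖exp (t • B) x - exp (t • B') x‖ ≤ t * ‖B x - B' x‖ := by
  have hd : ∀ s : ℝ, HasDerivAt (fun s : ℝ => exp (s • B) (exp ((t - s) • B') x))
      (exp (s • B) (exp ((t - s) • B') (B x - B' x))) s := fun s => by
    have h1 := (hasDerivAt_exp_smul_const B s)
    have h2 := ((hasDerivAt_exp_smul_const B' (t - s)).scomp s
      ((hasDerivAt_id s).const_sub t)).clm_apply (hasDerivAt_const s x)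
    have h3 := h1.clm_apply h2
    refine h3.congr_deriv ?_
    have hc' : B * exp ((t - s) • B') = exp ((t - s) • B') * B :=
      ((hc.smul_right (t - s)).exp_right)
    have hc'' : B (exp ((t - s) • B') x) = exp ((t - s) • B') (B x) := congr($hc' x)
    simp [hc'', ← sub_eq_add_neg]
  have h := norm_image_sub_le_of_norm_deriv_le_segment' (a := 0) (b := t)
    (C := ‖B x - B' x‖) (fun s _ => (hd s).hasDerivWithinAt) (fun s hs =>
      (norm_exp_smul_apply_le hB hs.1 _).trans
        (norm_exp_smul_apply_le hB' (by linarith [hs.2]) _)) t ⟨ht, le_rfl⟩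
  simpa [mul_comm] using h

open NormedSpace in
theorem norm_exp_smul_sub_self_le {B : X →L[ℝ] X} (hB : ∀ x, ⟪B x, x⟫ ≤ 0) {t : ℝ} (ht : 0 ≤ t)
    (x : X) : ‖exp (t • B) x - x‖ ≤ t * ‖B x‖ := by
  simpa using norm_exp_smul_sub_exp_smul_le (B' := 0) hB (by simp) (Commute.zero_right B) ht x

open NormedSpace in
-- A Taylor estimate that avoids `B² x`, which would not be controlled along the approximations: `B
-- x` is compared with a `y` for which `B y` stays bounded.
theorem norm_exp_smul_sub_self_sub_le {B : X →L[ℝ] X} (hB : ∀ x, ⟪B x, x⟫ ≤ 0) {t : ℝ}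
    (ht : 0 ≤ t) (x y : X) :
    ‖exp (t • B) x - x - t • B x‖ ≤ (2 * ‖B x - y‖ + t * ‖B y‖) * t := by
  have hd : ∀ s : ℝ, HasDerivAt (fun s : ℝ => exp (s • B) x - s • B x)
      (exp (s • B) (B x) - B x) s := fun s => by
    have h1 := (hasDerivAt_exp_smul_const B s).clm_apply (hasDerivAt_const s x)
    have h2 := (hasDerivAt_id s).smul_const (B x)
    refine (h1.sub h2).congr_deriv ?_
    simp
  have h := norm_image_sub_le_of_norm_deriv_le_segment' (a := 0) (b := t)
    (C := 2 * ‖B x - y‖ + t * ‖B y‖) (fun s _ => (hd s).hasDerivWithinAt) (fun s hs => by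
      have e : exp (s • B) (B x) - B x
          = exp (s • B) (B x - y) + (exp (s • B) y - y) - (B x - y) := by
        rw [map_sub]; abel
      have h1 := norm_exp_smul_apply_le hB hs.1 (B x - y)
      have h2 := norm_exp_smul_sub_self_le hB hs.1 y
      have h3 : s * ‖B y‖ ≤ t * ‖B y‖ := by gcongr; exact hs.2.le
      rw [e]
      calc _ ≤ ‖exp (s • B) (B x - y)‖ + ‖exp (s • B) y - y‖ + ‖B x - y‖ :=
            (norm_sub_le _ _).trans (by gcongr; exact norm_add_le _ _)
        _ ≤ _ := by linarith) t ⟨ht, le_rfl⟩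
  simp only [sub_zero, zero_smul, exp_zero, one_apply_eq_self] at h
  rwa [sub_right_comm]

open NormedSpace in
/-- The limit of the semigroups generated by commuting bounded dissipative operators which
converge on a dense set. -/
theorem exists_tendsto_exp {B : ℕ → X →L[ℝ] X} (hB : ∀ k x, ⟪B k x, x⟫ ≤ 0)
    (hc : ∀ k l, Commute (B k) (B l)) (hD : Dense {x | ∃ y, Tendsto (fun k => B k x) atTop (𝓝 y)}) :
    ∃ S : ℝ → X →L[ℝ] X, ∀ t, 0 ≤ t → ∀ x,
      Tendsto (fun k => exp (t • B k) x) atTop (𝓝 (S t x)) := by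
  have h1 : ∀ t : ℝ, 0 ≤ t → ∀ x, ∃ y, Tendsto (fun k => exp (t • B k) x) atTop (𝓝 y) := by
    intro t ht x
    apply cauchySeq_tendsto_of_complete
    rw [Metric.cauchySeq_iff']
    intro ε hε
    obtain ⟨x', ⟨y, hy⟩, hx'⟩ := hD.exists_dist_lt x (show 0 < ε / 4 by positivity)
    obtain ⟨N, hN⟩ := Metric.cauchySeq_iff'.1 hy.cauchySeq (ε / (2 * (t + 1))) (by positivity)
    refine ⟨N, fun k hk => ?_⟩
    have e : exp (t • B k) x - exp (t • B N) x = exp (t • B k) (x - x')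
        + (exp (t • B k) x' - exp (t • B N) x') - exp (t • B N) (x - x') := by
      simp only [map_sub]; abel
    have b1 := norm_exp_smul_apply_le (hB k) ht (x - x')
    have b2 := norm_exp_smul_apply_le (hB N) ht (x - x')
    have b3 := norm_exp_smul_sub_exp_smul_le (hB k) (hB N) (hc k N) ht x'
    have b4 := hN k hk
    rw [dist_eq_norm] at b4 hx' ⊢
    have b5 : t * ‖B k x' - B N x'‖ ≤ (t + 1) * (ε / (2 * (t + 1))) := by
      gcongr; linarith
    have b6 : (t + 1) * (ε / (2 * (t + 1))) = ε / 2 := by field_simp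
    rw [e]
    calc _ ≤ ‖exp (t • B k) (x - x')‖ + ‖exp (t • B k) x' - exp (t • B N) x'‖
          + ‖exp (t • B N) (x - x')‖ := (norm_sub_le _ _).trans (by gcongr; exact norm_add_le _ _)
      _ < ε := by linarith
  choose! F hF using h1
  refine ⟨fun t => if ht : 0 ≤ t then continuousLinearMapOfTendsto (fun k => exp (t • B k))
    (f := F t) (tendsto_pi_nhds.2 (hF t ht)) else 0, fun t ht x => ?_⟩
  simp only [dif_pos ht]
  exact hF t ht x

open NormedSpace in
/-- The limit semigroup is a `C₀`-semigroup of contractions, and its generator extends the limit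
of the approximating operators. -/
theorem isC0Semigroup_of_tendsto_exp {B : ℕ → X →L[ℝ] X} (hB : ∀ k x, ⟪B k x, x⟫ ≤ 0)
    (hD : Dense {x | ∃ y, Tendsto (fun k => B k x) atTop (𝓝 y)})
    {S : ℝ → X →L[ℝ] X} (hS : ∀ t, 0 ≤ t → ∀ x,
      Tendsto (fun k => exp (t • B k) x) atTop (𝓝 (S t x))) :
    IsC0Semigroup S ∧ (∀ t, 0 ≤ t → ∀ x, ‖S t x‖ ≤ ‖x‖) ∧
      ∀ x y, Tendsto (fun k => B k x) atTop (𝓝 y) →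
        Tendsto (fun t : ℝ => t⁻¹ • (S t x - x)) (𝓝[>] 0) (𝓝 y) := by
  have hcontr : ∀ t, 0 ≤ t → ∀ x, ‖S t x‖ ≤ ‖x‖ := fun t ht x =>
    le_of_tendsto (hS t ht x).norm (Eventually.of_forall fun k =>
      norm_exp_smul_apply_le (hB k) ht x)
  refine ⟨⟨?_, ?_, ?_⟩, hcontr, ?_⟩
  · ext x
    refine tendsto_nhds_unique (hS 0 le_rfl x) ?_
    simp
  · intro s t hs ht
    ext x
    refine tendsto_nhds_unique (hS (s + t) (add_nonneg hs ht) x) ?_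
    have h1 : Tendsto (fun k => exp (s • B k) (exp (t • B k) x - S t x)) atTop (𝓝 0) := by
      refine squeeze_zero_norm (fun k => norm_exp_smul_apply_le (hB k) hs _) ?_
      simpa using ((hS t ht x).sub_const (S t x)).norm
    have h2 := h1.add (hS s hs (S t x))
    simp only [← map_add, sub_add_cancel, zero_add] at h2
    refine h2.congr fun k => ?_
    let _ : NormedAlgebra ℚ (X →L[ℝ] X) := NormedAlgebra.restrictScalars ℚ ℝ _
    rw [add_smul, exp_add_of_commute (((Commute.refl (B k)).smul_left s).smul_right t)]
    rfl
  · intro x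
    rw [Metric.tendsto_nhds]
    intro ε hε
    obtain ⟨x', ⟨y, hy⟩, hx'⟩ := hD.exists_dist_lt x (show 0 < ε / 4 by positivity)
    have h1 : Tendsto (fun t : ℝ => t * ‖y‖) (𝓝[>] 0) (𝓝 0) := by
      have : Continuous fun t : ℝ => t * ‖y‖ := by fun_prop
      simpa using (this.tendsto 0).mono_left nhdsWithin_le_nhds
    filter_upwards [self_mem_nhdsWithin, h1.eventually (Iio_mem_nhds (half_pos hε))] with t ht ht1
    have ht0 : (0 : ℝ) ≤ t := le_of_lt ht
    have h2 : ‖S t x' - x'‖ ≤ t * ‖y‖ :=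
      le_of_tendsto_of_tendsto ((hS t ht0 x').sub_const x').norm (hy.norm.const_mul t)
        (Eventually.of_forall fun k => norm_exp_smul_sub_self_le (hB k) ht0 x')
    have e : S t x - x = S t (x - x') + (S t x' - x') - (x - x') := by
      rw [map_sub]; abel
    have ht1 : t * ‖y‖ < ε / 2 := ht1
    have h3 := hcontr t ht0 (x - x')
    rw [dist_eq_norm] at hx' ⊢
    rw [e]
    calc _ ≤ ‖S t (x - x')‖ + ‖S t x' - x'‖ + ‖x - x'‖ :=
          (norm_sub_le _ _).trans (by gcongr; exact norm_add_le _ _)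
      _ < ε := by linarith
  · intro x y hxy
    rw [Metric.tendsto_nhds]
    intro ε hε
    obtain ⟨y', ⟨z, hz⟩, hy'⟩ := hD.exists_dist_lt y (show 0 < ε / 4 by positivity)
    have h1 : Tendsto (fun t : ℝ => t * ‖z‖) (𝓝[>] 0) (𝓝 0) := by
      have : Continuous fun t : ℝ => t * ‖z‖ := by fun_prop
      simpa using (this.tendsto 0).mono_left nhdsWithin_le_nhds
    filter_upwards [self_mem_nhdsWithin, h1.eventually (Iio_mem_nhds (half_pos hε))] with t ht ht1
    have ht : 0 < t := ht
    have h2 : ‖S t x - x - t • y‖ ≤ (2 * ‖y - y'‖ + t * ‖z‖) * t :=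
      le_of_tendsto_of_tendsto (((hS t ht.le x).sub_const x).sub (hxy.const_smul t)).norm
        ((((hxy.sub_const y').norm.const_mul 2).add (hz.norm.const_mul t)).mul_const t)
        (Eventually.of_forall fun k => norm_exp_smul_sub_self_sub_le (hB k) ht.le x y')
    have e : t⁻¹ • (S t x - x) - y = t⁻¹ • (S t x - x - t • y) := by
      rw [smul_sub t⁻¹ (S t x - x), inv_smul_smul₀ ht.ne']
    have ht1 : t * ‖z‖ < ε / 2 := ht1
    rw [dist_eq_norm] at hy' ⊢
    rw [e, norm_smul, norm_inv, Real.norm_of_nonneg ht.le, inv_mul_lt_iff₀ ht]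
    refine h2.trans_lt ?_
    rw [mul_comm]
    gcongr
    linarith

/-- **Lumer–Phillips theorem** in a Hilbert space, for a dissipative operator given by its
resolvents. -/
theorem exists_isGeneratedBy_of_resolvent {G : Set (X × X)} (R : ℝ → X →L[ℝ] X)
    (hmem : ∀ l > 0, ∀ x, (R l x, l • R l x - x) ∈ G)
    (hinv : ∀ l > 0, ∀ x y, (x, y) ∈ G → R l (l • x - y) = x)
    (hzero : ∀ y, (0, y) ∈ G → y = 0)
    (hdiss : ∀ x y, (x, y) ∈ G → ⟪y, x⟫ ≤ 0) :
    Dense (Prod.fst '' G) ∧ ∃ S, IsGeneratedBy S G := by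
  have hnorm : ∀ l > 0, ∀ x, l * ‖R l x‖ ≤ ‖x‖ := by
    intro l hl x
    have h1 := hdiss _ _ (hmem l hl x)
    rw [inner_sub_left, inner_smul_left, real_inner_self_eq_norm_sq] at h1
    simp only [conj_trivial] at h1
    have h2 := real_inner_le_norm x (R l x)
    rcases eq_or_lt_of_le (norm_nonneg (R l x)) with h0 | h0
    · rw [← h0]; simp
    · nlinarith
  -- If `y` is orthogonal to the range of `R 1`, dissipativity gives `‖R 1 y‖ ^ 2 ≤ ⟪y, R 1 y⟫ = 0`;
  -- then `(0, -y) ∈ G`, so `y = 0`.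
  have hdense : Dense (Prod.fst '' G) := by
    have hD : Prod.fst '' G = (LinearMap.range (R 1).toLinearMap : Set X) := by
      ext x
      constructor
      · rintro ⟨⟨x, y⟩, h, rfl⟩
        exact ⟨_, hinv 1 one_pos x y h⟩
      · rintro ⟨y, rfl⟩
        exact ⟨_, hmem 1 one_pos y, rfl⟩
    rw [hD, Submodule.dense_iff_topologicalClosure_eq_top,
      Submodule.topologicalClosure_eq_top_iff, Submodule.eq_bot_iff]
    intro y hy
    rw [Submodule.mem_orthogonal] at hy
    have h1 : ⟪R 1 y, y⟫ = 0 := hy _ ⟨y, rfl⟩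
    have h2 := hdiss _ _ (hmem 1 one_pos y)
    rw [one_smul, inner_sub_left, real_inner_self_eq_norm_sq, real_inner_comm, h1] at h2
    have h3 : R 1 y = 0 := by
      have : ‖R 1 y‖ = 0 := by nlinarith [norm_nonneg (R 1 y)]
      simpa using this
    have h4 := hmem 1 one_pos y
    rw [h3, smul_zero, zero_sub] at h4
    simpa using hzero _ h4
  refine ⟨hdense, ?_⟩
  have hres : ∀ l > 0, ∀ m > 0, ∀ x, R l x = R m x - (l - m) • R l (R m x) := by
    intro l hl m hm x
    have h := hinv l hl _ _ (hmem m hm x)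
    rw [show l • R m x - (m • R m x - x) = (l - m) • R m x + x by rw [sub_smul]; abel,
      map_add, map_smul] at h
    rw [eq_sub_iff_add_eq, add_comm]
    exact h
  have hcomm : ∀ l > 0, ∀ m > 0, Commute (R l) (R m) := by
    intro l hl m hm
    rcases eq_or_ne l m with rfl | hne
    · exact Commute.refl _
    ext x
    have h1 := hres l hl m hm x
    have h2 := hres m hm l hl x
    have h3 : (l - m) • (R l (R m x) - R m (R l x)) = 0 := by
      have e1 : (l - m) • R l (R m x) = R m x - R l x := by rw [h1]; abel
      have e2 : (l - m) • R m (R l x) = R m x - R l x := by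
        rw [h2, sub_sub_cancel_left, ← neg_smul, neg_sub]
      rw [smul_sub, e1, e2, sub_self]
    simpa [sub_eq_zero, hne] using h3
  -- The Yosida approximations `L (L R(L) - 1)`, with `k + 1` in place of `k` to keep `L` positive.
  set L : ℕ → ℝ := fun k => k + 1 with hL
  have hLpos : ∀ k, 0 < L k := fun k => by positivity
  set B : ℕ → X →L[ℝ] X := fun k => L k • (L k • R (L k) - 1) with hBdef
  have hBapp : ∀ k x, B k x = L k • (L k • R (L k) x - x) := fun k x => rfl
  have hB : ∀ k x, ⟪B k x, x⟫ ≤ 0 := by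
    intro k x
    rw [hBapp, inner_smul_left, inner_sub_left, inner_smul_left, real_inner_self_eq_norm_sq]
    simp only [conj_trivial]
    have h1 := real_inner_le_norm (R (L k) x) x
    have h2 := hnorm _ (hLpos k) x
    have h3 : L k * ⟪R (L k) x, x⟫ ≤ ‖x‖ ^ 2 := by
      calc _ ≤ L k * (‖R (L k) x‖ * ‖x‖) := by gcongr
        _ = (L k * ‖R (L k) x‖) * ‖x‖ := by ring
        _ ≤ ‖x‖ * ‖x‖ := by gcongr
        _ = _ := by ring
    exact mul_nonpos_of_nonneg_of_nonpos (hLpos k).le (by linarith)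
  have hBc : ∀ k l, Commute (B k) (B l) := fun k l =>
    ((((((hcomm _ (hLpos k) _ (hLpos l)).smul_right (L l)).sub_right
      (Commute.one_right _)).smul_right (L l)).smul_left (L k)).sub_left
      (Commute.one_left _)).smul_left (L k)
  -- On the domain the error is `R (L k) y`, of order `1 / L k`; density and `‖L k • R (L k)‖ ≤ 1`
  -- do the rest.
  have hLR : ∀ x, Tendsto (fun k => L k • R (L k) x) atTop (𝓝 x) := by
    intro x
    rw [Metric.tendsto_atTop]
    intro ε hε
    obtain ⟨x', ⟨⟨x', y⟩, hxy, rfl⟩, hx'⟩ := hdense.exists_dist_lt x (show 0 < ε / 4 by positivity)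
    obtain ⟨N, hN⟩ := exists_nat_gt (2 * ‖y‖ / ε)
    refine ⟨N, fun k hk => ?_⟩
    have e : L k • R (L k) x - x = L k • R (L k) (x - x') + R (L k) y - (x - x') := by
      have := hinv _ (hLpos k) _ _ hxy
      rw [map_sub, map_smul, sub_eq_iff_eq_add] at this
      rw [map_sub, smul_sub, this]; abel
    have h1 := hnorm _ (hLpos k) (x - x')
    have h2 := hnorm _ (hLpos k) y
    have h3 : ‖L k • R (L k) (x - x')‖ ≤ ‖x - x'‖ := by
      rwa [norm_smul, Real.norm_of_nonneg (hLpos k).le]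
    have h4 : ‖R (L k) y‖ < ε / 2 := by
      rw [div_lt_iff₀ hε] at hN
      have h5 : (N : ℝ) ≤ k := by exact_mod_cast hk
      have h6 : (k : ℝ) < L k := by simp [hL]
      have h7 : 2 * ‖y‖ < L k * ε := by nlinarith
      by_contra! h8
      nlinarith [hLpos k]
    rw [dist_eq_norm] at hx' ⊢
    simp only at hx'
    rw [e]
    calc _ ≤ ‖L k • R (L k) (x - x')‖ + ‖R (L k) y‖ + ‖x - x'‖ :=
          (norm_sub_le _ _).trans (by gcongr; exact norm_add_le _ _)
      _ < ε := by linarith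
  have hBt : ∀ x y, (x, y) ∈ G → Tendsto (fun k => B k x) atTop (𝓝 y) := by
    intro x y hxy
    refine (hLR y).congr fun k => ?_
    have := hinv _ (hLpos k) _ _ hxy
    rw [map_sub, map_smul, sub_eq_iff_eq_add] at this
    rw [hBapp, this, add_sub_cancel_left]
  have hD : Dense {x | ∃ y, Tendsto (fun k => B k x) atTop (𝓝 y)} :=
    hdense.mono (by rintro _ ⟨⟨x, y⟩, h, rfl⟩; exact ⟨y, hBt x y h⟩)
  obtain ⟨S, hS⟩ := exists_tendsto_exp hB hBc hD
  obtain ⟨h1, h2, h3⟩ := isC0Semigroup_of_tendsto_exp hB hD hS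
  refine ⟨S, h1, fun x y => ⟨fun h => h3 x y (hBt x y h), fun h => ?_⟩⟩
  -- A priori the generator is only an extension of `G`. It is dissipative, since the semigroup is
  -- contractive; applied to the difference of `(x, y)` and the element of `G` with the same image
  -- under `1 - 𝒜`, this gives `‖x - x'‖ ^ 2 ≤ 0`.
  have h4 := hmem 1 one_pos (x - y)
  set x' := R 1 (x - y)
  rw [one_smul] at h4
  have h5 := h.sub (h3 _ _ (hBt _ _ h4))
  have h6 : ⟪y - (x' - (x - y)), x - x'⟫ ≤ 0 := by
    refine le_of_tendsto (h5.inner tendsto_const_nhds) ?_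
    filter_upwards [self_mem_nhdsWithin] with t ht
    have ht : 0 < t := ht
    have e : t⁻¹ • (S t x - x) - t⁻¹ • (S t x' - x')
        = t⁻¹ • (S t (x - x') - (x - x')) := by
      rw [map_sub, ← smul_sub]; congr 1; abel
    rw [e, inner_smul_left, inner_sub_left, real_inner_self_eq_norm_sq]
    have h7 := real_inner_le_norm (S t (x - x')) (x - x')
    have h8 := h2 t ht.le (x - x')
    have h9 : ‖S t (x - x')‖ * ‖x - x'‖ ≤ ‖x - x'‖ ^ 2 := by rw [sq]; gcongr
    exact mul_nonpos_of_nonneg_of_nonpos (by simpa using ht.le) (by linarith)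
  rw [show y - (x' - (x - y)) = x - x' by abel, real_inner_self_eq_norm_sq] at h6
  have h7 : x = x' := by
    have : ‖x - x'‖ = 0 := by nlinarith [norm_nonneg (x - x')]
    simpa [sub_eq_zero] using this
  rw [← h7, sub_sub_cancel] at h4
  exact h4

/-- Lumer–Phillips theorem for an operator `Λ ∘ ι⁻¹` which is quasi-dissipative in an equivalent
inner product. -/
theorem exists_isGeneratedBy_of_dissipative {E : Type*} [AddCommGroup E] [Module ℝ E]
    (J : X ≃L[ℝ] X) (ι Λ : E →ₗ[ℝ] X) (ω : ℝ) (hι : Function.Injective ι)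
    (hdiss : ∀ e, ⟪J (Λ e), J (ι e)⟫ ≤ ω * ‖J (ι e)‖ ^ 2)
    (hsurj : ∀ l > ω, Function.Surjective (l • ι - Λ)) :
    Dense (Set.range ι) ∧ ∃ S, IsGeneratedBy S (Set.range fun e => (ι e, Λ e)) := by
  -- Conjugation by `J` and the shift by `ω` produce a dissipative operator; both are undone at the
  -- end through `e^{ωt} J⁻¹ S(t) J`.
  set G : Set (X × X) := Set.range fun e => (J (ι e), J (Λ e) - ω • J (ι e)) with hG
  have hdiss' : ∀ e, ⟪J (Λ e) - ω • J (ι e), J (ι e)⟫ ≤ 0 := fun e => by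
    rw [inner_sub_left, inner_smul_left, real_inner_self_eq_norm_sq]
    simpa using hdiss e
  have hbound : ∀ l > 0, ∀ e, l * ‖J (ι e)‖ ≤ ‖J (((ω + l) • ι - Λ) e)‖ := by
    intro l hl e
    have h1 := real_inner_le_norm (J (((ω + l) • ι - Λ) e)) (J (ι e))
    have h2 : ⟪J (((ω + l) • ι - Λ) e), J (ι e)⟫
        = l * ‖J (ι e)‖ ^ 2 - ⟪J (Λ e) - ω • J (ι e), J (ι e)⟫ := by
      simp only [LinearMap.sub_apply, LinearMap.smul_apply, map_sub, map_smul, inner_sub_left,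
        inner_smul_left, real_inner_self_eq_norm_sq, conj_trivial]
      ring
    have h3 := hdiss' e
    rcases eq_or_lt_of_le (norm_nonneg (J (ι e))) with h0 | h0
    · rw [← h0]; simp
    · nlinarith
  have hbij : ∀ l > 0, Function.Bijective ((ω + l) • ι - Λ) := by
    intro l hl
    refine ⟨(injective_iff_map_eq_zero _).2 fun e he => ?_, hsurj _ (by linarith)⟩
    have := hbound l hl e
    rw [he, map_zero, norm_zero] at this
    have : ‖J (ι e)‖ = 0 := by nlinarith [norm_nonneg (J (ι e))]
    simpa [map_eq_zero_iff ι hι] using this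
  -- For `l ≤ 0` the value is `0` by default and plays no role.
  have hR : ∀ l : ℝ, ∃ R : X →L[ℝ] X, 0 < l → ∀ e, R (J (((ω + l) • ι - Λ) e)) = J (ι e) := by
    intro l
    by_cases hl : 0 < l
    swap
    · exact ⟨0, fun h => absurd h hl⟩
    set M := LinearEquiv.ofBijective _ (hbij l hl) with hM
    refine ⟨LinearMap.mkContinuous (J.toLinearEquiv.toLinearMap ∘ₗ ι ∘ₗ M.symm.toLinearMap ∘ₗ
      J.symm.toLinearEquiv.toLinearMap) l⁻¹ fun x => ?_, fun _ e => ?_⟩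
    · obtain ⟨y, rfl⟩ := J.surjective x
      obtain ⟨e, rfl⟩ := M.surjective y
      have := hbound l hl e
      rw [← le_inv_mul_iff₀ hl] at this
      simpa only [LinearMap.comp_apply, LinearEquiv.coe_coe, ContinuousLinearEquiv.coe_toLinearEquiv,
        ContinuousLinearEquiv.coe_symm_toLinearEquiv, ContinuousLinearEquiv.symm_apply_apply,
        LinearEquiv.symm_apply_apply, M, LinearEquiv.ofBijective_apply,
        show (LinearEquiv.ofBijective _ (hbij l hl)).symm (((ω + l) • ι - Λ) e) = e from
          M.symm_apply_apply e] using this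
    · have : M.symm (((ω + l) • ι - Λ) e) = e := M.symm_apply_apply e
      simp [-LinearMap.sub_apply, -LinearMap.smul_apply, this]
  choose R hR using hR
  have hrep : ∀ l > 0, ∀ x, ∃ e, x = J (((ω + l) • ι - Λ) e) := fun l hl x => by
    obtain ⟨y, rfl⟩ := J.surjective x
    obtain ⟨e, rfl⟩ := (hbij l hl).2 y
    exact ⟨e, rfl⟩
  obtain ⟨hd, S, hS0, hS⟩ := exists_isGeneratedBy_of_resolvent (G := G) R
    (fun l hl x => by
      obtain ⟨e, rfl⟩ := hrep l hl x
      rw [hR l hl]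
      refine ⟨e, ?_⟩
      simp only [LinearMap.sub_apply, LinearMap.smul_apply, map_sub, map_smul, Prod.mk.injEq,
        true_and]
      module)
    (fun l hl x y => by
      rintro ⟨e, he⟩
      obtain ⟨rfl, rfl⟩ := Prod.mk.inj he
      rw [show l • J (ι e) - (J (Λ e) - ω • J (ι e)) = J (((ω + l) • ι - Λ) e) by
        simp only [LinearMap.sub_apply, LinearMap.smul_apply, map_sub, map_smul]
        module, hR l hl])
    (fun y => by
      rintro ⟨e, he⟩
      obtain ⟨h1, rfl⟩ := Prod.mk.inj he
      have : e = 0 := by simpa [map_eq_zero_iff ι hι] using h1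
      simp [this])
    (fun x y => by
      rintro ⟨e, he⟩
      obtain ⟨rfl, rfl⟩ := Prod.mk.inj he
      exact hdiss' e)
  constructor
  · have h1 : Set.range ι = J.symm '' (Prod.fst '' G) := by
      rw [hG, ← Set.range_comp, ← Set.range_comp]
      congr 1
      ext e
      simp
    rw [h1]
    exact J.symm.surjective.denseRange.dense_image J.symm.continuous hd
  refine ⟨fun t => Real.exp (ω * t) • (J.symm.toContinuousLinearMap.comp
    ((S t).comp J.toContinuousLinearMap)), ⟨?_, ?_, ?_⟩, ?_⟩
  · ext x
    simp [hS0.zero]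
  · intro s t hs ht
    ext x
    simp [hS0.add s t hs ht, mul_add, Real.exp_add, mul_smul, smul_comm (Real.exp (ω * s))]
  · intro x
    have h1 : Tendsto (fun t : ℝ => Real.exp (ω * t)) (𝓝[>] 0) (𝓝 1) := by
      have : Continuous fun t : ℝ => Real.exp (ω * t) := by fun_prop
      simpa using (this.tendsto 0).mono_left nhdsWithin_le_nhds
    simpa using h1.smul ((J.symm.continuous.tendsto _).comp (hS0.strong (J x)))
  · intro x y
    have h0 : (x, y) ∈ Set.range (fun e => (ι e, Λ e)) ↔ (J x, J y - ω • J x) ∈ G := by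
      simp only [hG, Set.mem_range, Prod.mk.injEq]
      refine exists_congr fun e => ?_
      constructor
      · rintro ⟨rfl, rfl⟩; exact ⟨rfl, rfl⟩
      · rintro ⟨h1, h2⟩
        rw [h1] at h2
        exact ⟨J.injective h1, J.injective (sub_left_injective h2)⟩
    have hexp : ∀ c : ℝ, Tendsto (fun t : ℝ => Real.exp (c * t)) (𝓝[>] 0) (𝓝 1) := fun c => by
      have : Continuous fun t : ℝ => Real.exp (c * t) := by fun_prop
      simpa using (this.tendsto 0).mono_left nhdsWithin_le_nhds
    have hexp' : ∀ c : ℝ, Tendsto (fun t : ℝ => t⁻¹ * (Real.exp (c * t) - 1)) (𝓝[>] 0) (𝓝 c) := by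
      intro c
      have h1 : HasDerivAt (fun t : ℝ => Real.exp (c * t)) c 0 := by
        have := ((hasDerivAt_id (0 : ℝ)).const_mul c).exp
        simpa using this
      have h2 := hasDerivAt_iff_tendsto_slope_zero.1 h1
      have h3 := h2.mono_left (nhdsWithin_mono 0 (s := Set.Ioi 0) fun t ht => ne_of_gt ht)
      simpa using h3
    rw [h0, hS]
    constructor
    · intro h
      have h1 := (J.symm.continuous.tendsto _).comp
        (((hexp ω).smul h).add ((hexp' ω).smul_const (J x)))
      simp only [one_smul, sub_add_cancel, ContinuousLinearEquiv.symm_apply_apply] at h1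
      refine h1.congr fun t => ?_
      simp only [Function.comp_apply, map_add, map_smul, map_sub, smul_apply,
        ContinuousLinearMap.comp_apply, ContinuousLinearEquiv.coe_coe,
        ContinuousLinearEquiv.symm_apply_apply]
      module
    · intro h
      have h1 := (J.continuous.tendsto _).comp
        (((hexp (-ω)).smul h).add ((hexp' (-ω)).smul_const x))
      simp only [one_smul, neg_smul, ← sub_eq_add_neg, map_sub, map_smul] at h1
      refine h1.congr fun t => ?_
      have h2 : Real.exp (-ω * t) * Real.exp (ω * t) = 1 := by
        rw [← Real.exp_add]; simp
      simp only [Function.comp_apply, map_add, map_smul, map_sub, smul_apply, smul_sub, smul_smul,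
        ContinuousLinearMap.comp_apply, ContinuousLinearEquiv.coe_coe,
        ContinuousLinearEquiv.apply_symm_apply]
      rw [show Real.exp (-ω * t) * (t⁻¹ * Real.exp (ω * t)) = t⁻¹ by
        rw [mul_left_comm, h2, mul_one]]
      module

end LumerPhillips

/-- As the interval has length one, the `L₂` norm dominates the `L₁` norm and is dominated by the
supremum, with constant `1`. -/
instance : IsProbabilityMeasure (lebesgueOn (-1) 0) := ⟨by simp⟩

/-! ### Extension by zero, reflection and exponential weights on `L₂(-1, 0)`. -/

section Extension

variable {E : Type*} [NormedAddCommGroup E]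

/-- Extension by zero outside `[-1, 0]`. -/
def ext (f : ℝ → E) : ℝ → E := (Set.Icc (-1) 0).indicator f

theorem ext_of_mem {f : ℝ → E} {s : ℝ} (hs : s ∈ Set.Icc (-1 : ℝ) 0) : ext f s = f s :=
  Set.indicator_of_mem hs f

theorem ext_of_notMem {f : ℝ → E} {s : ℝ} (hs : s ∉ Set.Icc (-1 : ℝ) 0) : ext f s = 0 :=
  Set.indicator_of_notMem hs f

theorem ext_congr {f g : ℝ → E} (h : f =ᵐ[lebesgueOn (-1) 0] g) : ext f =ᵐ[volume] ext g := by
  rw [EventuallyEq, ae_restrict_iff' measurableSet_Icc] at h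
  filter_upwards [h] with s hs
  by_cases h1 : s ∈ Set.Icc (-1 : ℝ) 0
  · rw [ext_of_mem h1, ext_of_mem h1, hs h1]
  · rw [ext_of_notMem h1, ext_of_notMem h1]

theorem ext_ae_eq (f : ℝ → E) : ext f =ᵐ[lebesgueOn (-1) 0] f := by
  filter_upwards [ae_restrict_mem measurableSet_Icc] with s hs
  exact ext_of_mem hs

theorem ext_add_ae (f g : Lp E 2 (lebesgueOn (-1) 0)) :
    ext ⇑(f + g) =ᵐ[volume] fun s => ext f s + ext g s := by
  filter_upwards [ext_congr (Lp.coeFn_add f g)] with s hs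
  rw [hs]
  exact congrFun (Set.indicator_add _ _ _) s

theorem ext_neg_ae (f : Lp E 2 (lebesgueOn (-1) 0)) :
    ext ⇑(-f) =ᵐ[volume] fun s => -ext f s := by
  filter_upwards [ext_congr (Lp.coeFn_neg f)] with s hs
  rw [hs]
  exact congrFun (Set.indicator_neg _ _) s

theorem ext_smul_ae [NormedSpace ℝ E] (c : ℝ) (f : Lp E 2 (lebesgueOn (-1) 0)) :
    ext ⇑(c • f) =ᵐ[volume] fun s => c • ext f s := by
  filter_upwards [ext_congr (Lp.coeFn_smul c f)] with s hs
  rw [hs]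
  exact congrFun (Set.indicator_const_smul _ c _) s

theorem memLp_ext (f : Lp E 2 (lebesgueOn (-1) 0)) : MemLp (ext f) 2 volume :=
  (memLp_indicator_iff_restrict measurableSet_Icc).2 (Lp.memLp f)

theorem integrable_ext (f : Lp E 2 (lebesgueOn (-1) 0)) : Integrable (ext f) :=
  (integrable_indicator_iff measurableSet_Icc).2 ((Lp.memLp f).integrable (by norm_num))

theorem integral_norm_ext_le (f : Lp E 2 (lebesgueOn (-1) 0)) : ∫ s, ‖ext f s‖ ≤ ‖f‖ := by
  have h1 : ∫ s, ‖ext f s‖ = ∫ s, ‖f s‖ ∂lebesgueOn (-1) 0 := by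
    rw [← integral_indicator measurableSet_Icc]
    congr 1
    ext s
    simp [ext, norm_indicator_eq_indicator_norm]
  have h2 := (Lp.memLp f).1
  rw [h1, integral_norm_eq_lintegral_enorm h2, ← eLpNorm_one_eq_lintegral_enorm, Lp.norm_def]
  refine ENNReal.toReal_mono (Lp.memLp f).2.ne ?_
  exact eLpNorm_le_eLpNorm_of_exponent_le (by norm_num) h2

theorem norm_intervalIntegral_ext_le [NormedSpace ℝ E] (f : Lp E 2 (lebesgueOn (-1) 0)) (a b : ℝ) :
    ‖∫ s in a..b, ext f s‖ ≤ ‖f‖ :=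
  (intervalIntegral.norm_integral_le_integral_norm_uIoc).trans
    ((setIntegral_le_integral (integrable_ext f).norm
      (Eventually.of_forall fun _ => norm_nonneg _)).trans (integral_norm_ext_le f))

theorem intervalIntegral_ext {f : ℝ → E} [NormedSpace ℝ E] {a b : ℝ}
    (ha : a ∈ Set.Icc (-1 : ℝ) 0) (hb : b ∈ Set.Icc (-1 : ℝ) 0) :
    ∫ s in a..b, ext f s = ∫ s in a..b, f s :=
  intervalIntegral.integral_congr fun _ hs =>
    ext_of_mem (Set.uIcc_subset_Icc ha hb hs)

/-- The reflection `θ ↦ -1 - θ` of `[-1, 0]` preserves Lebesgue measure. -/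
theorem measurePreserving_reflect :
    MeasurePreserving (fun θ : ℝ => -1 - θ) (lebesgueOn (-1) 0) (lebesgueOn (-1) 0) := by
  have h := (Measure.measurePreserving_sub_left volume (-1 : ℝ)).restrict_preimage
    (measurableSet_Icc (a := (-1 : ℝ)) (b := 0))
  have h1 : (fun θ : ℝ => -1 - θ) ⁻¹' Set.Icc (-1) 0 = Set.Icc (-1) 0 := by
    rw [Set.preimage_const_sub_Icc]; norm_num
  rwa [h1] at h

variable [NormedSpace ℝ E]

/-- The operator `f ↦ f(-1 - ·)` on `L₂(-1, 0; E)`. -/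
def reflect : Lp E 2 (lebesgueOn (-1) 0) →L[ℝ] Lp E 2 (lebesgueOn (-1) 0) :=
  (Lp.compMeasurePreservingₗᵢ ℝ _ measurePreserving_reflect).toContinuousLinearMap

theorem coeFn_reflect (f : Lp E 2 (lebesgueOn (-1) 0)) :
    reflect f =ᵐ[lebesgueOn (-1) 0] fun θ => f (-1 - θ) :=
  Lp.coeFn_compMeasurePreserving f measurePreserving_reflect

theorem reflect_reflect (f : Lp E 2 (lebesgueOn (-1) 0)) : reflect (reflect f) = f := by
  refine Lp.ext ?_
  filter_upwards [coeFn_reflect (reflect f),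
    measurePreserving_reflect.quasiMeasurePreserving.ae_eq_comp (coeFn_reflect f)] with s h1 h2
  rw [h1]
  simpa using h2

theorem ext_reflect (f : Lp E 2 (lebesgueOn (-1) 0)) :
    ext (reflect f) =ᵐ[volume] fun s => ext f (-1 - s) := by
  filter_upwards [ext_congr (coeFn_reflect f)] with s hs
  rw [hs]
  by_cases h1 : s ∈ Set.Icc (-1 : ℝ) 0
  · rw [ext_of_mem h1, ext_of_mem]
    constructor <;> linarith [h1.1, h1.2]
  · rw [ext_of_notMem h1, ext_of_notMem]
    contrapose! h1
    constructor <;> linarith [h1.1, h1.2]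

theorem memLp_exp_smul (c : ℝ) (f : Lp E 2 (lebesgueOn (-1) 0)) :
    MemLp (fun θ => Real.exp (c * θ) • f θ) 2 (lebesgueOn (-1) 0) := by
  refine (Lp.memLp f).of_le_mul (c := Real.exp |c|)
    ((by fun_prop : Continuous fun θ : ℝ => Real.exp (c * θ)).aestronglyMeasurable.smul
      (Lp.memLp f).1) ?_
  filter_upwards [ae_restrict_mem measurableSet_Icc] with s hs
  rw [norm_smul, Real.norm_of_nonneg (Real.exp_pos _).le]
  gcongr
  have h1 : |s| ≤ 1 := abs_le.2 ⟨hs.1, by linarith [hs.2]⟩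
  calc c * s ≤ |c * s| := le_abs_self _
    _ = |c| * |s| := abs_mul _ _
    _ ≤ |c| * 1 := by gcongr
    _ = |c| := mul_one _

/-- Multiplication with `e^{cθ}` on `L₂(-1, 0; E)`. -/
def mulExp (c : ℝ) : Lp E 2 (lebesgueOn (-1) 0) →L[ℝ] Lp E 2 (lebesgueOn (-1) 0) :=
  LinearMap.mkContinuous
    { toFun := fun f => (memLp_exp_smul c f).toLp
      map_add' := fun f g => by
        rw [← MemLp.toLp_add]
        refine MemLp.toLp_congr _ _ ?_
        filter_upwards [Lp.coeFn_add f g] with s hs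
        simp only [Pi.add_apply, hs, smul_add]
      map_smul' := fun r f => by
        rw [RingHom.id_apply, ← MemLp.toLp_const_smul]
        refine MemLp.toLp_congr _ _ ?_
        filter_upwards [Lp.coeFn_smul r f] with s hs
        simp [hs, smul_comm r] }
    (Real.exp |c|) fun f => by
      refine Lp.norm_le_mul_norm_of_ae_le_mul ?_
      filter_upwards [(memLp_exp_smul c f).coeFn_toLp,
        ae_restrict_mem measurableSet_Icc] with s hs1 hs
      simp only [LinearMap.coe_mk, AddHom.coe_mk]
      rw [hs1, norm_smul, Real.norm_of_nonneg (Real.exp_pos _).le]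
      gcongr
      have h1 : |s| ≤ 1 := abs_le.2 ⟨hs.1, by linarith [hs.2]⟩
      calc c * s ≤ |c * s| := le_abs_self _
        _ = |c| * |s| := abs_mul _ _
        _ ≤ |c| * 1 := by gcongr
        _ = |c| := mul_one _

theorem coeFn_mulExp (c : ℝ) (f : Lp E 2 (lebesgueOn (-1) 0)) :
    mulExp c f =ᵐ[lebesgueOn (-1) 0] fun θ => Real.exp (c * θ) • f θ :=
  (memLp_exp_smul c f).coeFn_toLp

theorem mulExp_mulExp_neg (c : ℝ) (f : Lp E 2 (lebesgueOn (-1) 0)) :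
    mulExp c (mulExp (-c) f) = f := by
  refine Lp.ext ?_
  filter_upwards [coeFn_mulExp c (mulExp (-c) f), coeFn_mulExp (-c) f] with s h1 h2
  rw [h1, h2, smul_smul, ← Real.exp_add]
  simp

theorem ext_mulExp (c : ℝ) (f : Lp E 2 (lebesgueOn (-1) 0)) :
    ext (mulExp c f) =ᵐ[volume] fun s => Real.exp (c * s) • ext f s := by
  filter_upwards [ext_congr (coeFn_mulExp c f)] with s hs
  rw [hs]
  by_cases h1 : s ∈ Set.Icc (-1 : ℝ) 0
  · rw [ext_of_mem h1, ext_of_mem h1]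
  · rw [ext_of_notMem h1, ext_of_notMem h1, smul_zero]

end Extension

/-! ### The coordinates `(φ(0), φ')` on `H¹`. -/

section History

variable {n : ℕ}

/-- The function `θ ↦ a + ∫₀^θ g` on `[-1, 0]`, for `e = (a, g)`, extended by constants. -/
def hist (e : M2 n) (θ : ℝ) : Vec n := e.fst + ∫ s in (0 : ℝ)..θ, ext e.snd s

theorem hist_zero (e : M2 n) : hist e 0 = e.fst := by simp [hist]

theorem hist_of_nonneg (e : M2 n) {θ : ℝ} (hθ : 0 ≤ θ) : hist e θ = e.fst := by
  rw [hist, intervalIntegral.integral_zero_ae, add_zero]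
  refine Eventually.of_forall fun s hs => ext_of_notMem fun h => ?_
  rw [Set.uIoc_of_le hθ] at hs
  exact absurd hs.1 (not_lt.2 h.2)

theorem continuous_hist (e : M2 n) : Continuous (hist e) :=
  continuous_const.add (intervalIntegral.continuous_primitive
    (fun _ _ => (integrable_ext e.snd).intervalIntegrable) 0)

theorem hist_sub_hist (e : M2 n) (a b : ℝ) : hist e b - hist e a = ∫ s in a..b, ext e.snd s := by
  have h : ∀ a b, IntervalIntegrable (ext e.snd) volume a b := fun _ _ =>
    (integrable_ext e.snd).intervalIntegrable
  simp only [hist]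
  rw [add_sub_add_left_eq_sub, intervalIntegral.integral_interval_sub_left (h _ _) (h _ _)]

theorem isH1_hist (e : M2 n) : IsH1 (hist e) e.snd := fun θ hθ => by
  rw [hist_zero, hist, intervalIntegral_ext (by simp) hθ]

theorem IsH1.eq_hist {φ : ℝ → Vec n} {g : L2 (-1) 0 n} (h : IsH1 φ g) {θ : ℝ}
    (hθ : θ ∈ Set.Icc (-1 : ℝ) 0) : φ θ = hist (WithLp.toLp 2 (φ 0, g)) θ := by
  rw [h θ hθ, hist, WithLp.toLp_fst, WithLp.toLp_snd, intervalIntegral_ext (by simp) hθ]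

theorem norm_hist_le (e : M2 n) (θ : ℝ) : ‖hist e θ‖ ≤ 2 * ‖e‖ := by
  have h1 := WithLp.norm_fst_le _ e
  have h2 := WithLp.norm_snd_le _ e
  have h3 := norm_intervalIntegral_ext_le e.snd 0 θ
  calc _ ≤ ‖e.fst‖ + ‖∫ s in (0 : ℝ)..θ, ext e.snd s‖ := norm_add_le _ _
    _ ≤ 2 * ‖e‖ := by linarith

theorem hist_add (e e' : M2 n) (θ : ℝ) : hist (e + e') θ = hist e θ + hist e' θ := by
  have h : ∀ e : M2 n, IntervalIntegrable (ext e.snd) volume 0 θ := fun e =>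
    (integrable_ext e.snd).intervalIntegrable
  rw [hist, WithLp.add_fst, WithLp.add_snd, intervalIntegral.integral_congr_ae
    ((ext_add_ae e.snd e'.snd).mono fun s hs _ => hs), intervalIntegral.integral_add (h e) (h e')]
  simp only [hist]
  abel

theorem hist_smul (c : ℝ) (e : M2 n) (θ : ℝ) : hist (c • e) θ = c • hist e θ := by
  rw [hist, WithLp.smul_fst, WithLp.smul_snd, intervalIntegral.integral_congr_ae
    ((ext_smul_ae c e.snd).mono fun s hs _ => hs), intervalIntegral.integral_smul, hist, smul_add]

/-- The evaluation `(a, g) ↦ a + ∫₀^θ g`. -/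
def evalL (θ : ℝ) : M2 n →L[ℝ] Vec n :=
  LinearMap.mkContinuous
    { toFun := fun e => hist e θ
      map_add' := fun e e' => hist_add e e' θ
      map_smul' := fun c e => hist_smul c e θ } 2 fun e => norm_hist_le e θ

@[simp] theorem evalL_apply (θ : ℝ) (e : M2 n) : evalL θ e = hist e θ := rfl

theorem memLp_hist (e : M2 n) : MemLp (hist e) 2 (lebesgueOn (-1) 0) :=
  MemLp.of_bound (continuous_hist e).aestronglyMeasurable (2 * ‖e‖)
    (Eventually.of_forall fun θ => norm_hist_le e θ)

/-- The operator which maps `(a, g)` to the function `θ ↦ a + ∫₀^θ g` in `L₂`. -/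
def histL : M2 n →L[ℝ] L2 (-1) 0 n :=
  LinearMap.mkContinuous
    { toFun := fun e => (memLp_hist e).toLp
      map_add' := fun e e' => by
        rw [← MemLp.toLp_add]
        exact MemLp.toLp_congr _ _ (Eventually.of_forall fun θ => hist_add e e' θ)
      map_smul' := fun c e => by
        rw [RingHom.id_apply, ← MemLp.toLp_const_smul]
        exact MemLp.toLp_congr _ _ (Eventually.of_forall fun θ => hist_smul c e θ) } 2
    fun e => by
      have h := Lp.norm_le_of_ae_bound (f := (memLp_hist e).toLp) (C := 2 * ‖e‖) (by positivity)
        (by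
          filter_upwards [(memLp_hist e).coeFn_toLp] with θ hθ
          rw [hθ]
          exact norm_hist_le e θ)
      simpa [measureUnivNNReal] using h

theorem coeFn_histL (e : M2 n) : histL e =ᵐ[lebesgueOn (-1) 0] hist e :=
  (memLp_hist e).coeFn_toLp

/-- The history vanishes on `[-1, 0]` by continuity, so its value at `0` is zero, and its derivative
is zero almost everywhere by Lebesgue differentiation. -/
theorem eq_zero_of_histL_eq_zero {e : M2 n} (h : histL e = 0) : e = 0 := by
  have h1 : hist e =ᵐ[lebesgueOn (-1) 0] fun _ => 0 := by
    refine (coeFn_histL e).symm.trans ?_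
    rw [h]
    exact Lp.coeFn_zero _ _ _
  have h2 : Set.EqOn (hist e) (fun _ => 0) (Set.Icc (-1) 0) :=
    Measure.eqOn_Icc_of_ae_eq volume (by norm_num) h1 (continuous_hist e).continuousOn
      continuousOn_const
  have h3 : e.fst = 0 := by rw [← hist_zero]; exact h2 (by simp)
  have h4 : e.snd = 0 := by
    refine Lp.ext ?_
    have h5 := LocallyIntegrable.ae_hasDerivAt_integral (integrable_ext e.snd).locallyIntegrable
    have h6 : ∀ᵐ s ∂lebesgueOn (-1) 0, s ∈ Set.Ioo (-1 : ℝ) 0 := by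
      rw [lebesgueOn, ← restrict_Ioo_eq_restrict_Icc]
      exact ae_restrict_mem measurableSet_Ioo
    filter_upwards [ae_restrict_of_ae h5, h6, Lp.coeFn_zero (Vec n) 2 (lebesgueOn (-1) 0)]
      with s hs hs1 hs2
    have h7 : HasDerivAt (hist e) (ext e.snd s) s := (hs 0).const_add e.fst
    have h8 : HasDerivAt (hist e) 0 s := by
      refine (hasDerivAt_const s (0 : Vec n)).congr_of_eventuallyEq ?_
      filter_upwards [Ioo_mem_nhds hs1.1 hs1.2] with r hr
      exact h2 ⟨hr.1.le, hr.2.le⟩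
    rw [hs2, ← ext_of_mem (f := e.snd) ⟨hs1.1.le, hs1.2.le⟩, h7.unique h8]
    rfl
  have : e = WithLp.toLp 2 (e.fst, e.snd) := rfl
  rw [this, h3, h4]
  rfl

end History

/-! ### Integration by parts for absolutely continuous functions. -/

section IntegrationByParts

variable {E F G : Type*} [NormedAddCommGroup E] [NormedSpace ℝ E] [NormedAddCommGroup F]
  [NormedSpace ℝ F] [NormedAddCommGroup G] [NormedSpace ℝ G] [CompleteSpace E] [CompleteSpace F]
  [CompleteSpace G]

/-- Integration by parts for a bilinear expression in two primitives. -/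
theorem integral_bilin_primitive (B : E →L[ℝ] F →L[ℝ] G) {u : ℝ → E} {v : ℝ → F}
    (hu : Integrable u) (hv : Integrable v) {a b : ℝ} (hab : a ≤ b) :
    ∫ t in a..b, (B (u t) (∫ s in t..b, v s) + B (∫ s in t..b, u s) (v t))
      = B (∫ t in a..b, u t) (∫ t in a..b, v t) := by
  have hu' : ∀ a b, IntervalIntegrable u volume a b := fun _ _ => hu.intervalIntegrable
  have hv' : ∀ a b, IntervalIntegrable v volume a b := fun _ _ => hv.intervalIntegrable
  set μ : Measure ℝ := volume.restrict (Set.Ioc a b) with hμ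
  have hf : Integrable (fun z : ℝ × ℝ => B (u z.1) (v z.2)) (μ.prod μ) :=
    hu.restrict.op_fst_snd (op := fun x y => B x y) B.continuous₂
      ⟨‖B‖, fun x y => B.le_opNorm₂ x y⟩ hv.restrict
  have hlt : MeasurableSet {z : ℝ × ℝ | z.2 < z.1} := measurableSet_lt measurable_snd measurable_fst
  have hf' : Integrable ({z : ℝ × ℝ | z.2 < z.1}.indicator fun z => B (u z.1) (v z.2))
    (μ.prod μ) := hf.indicator hlt
  have hI : ∀ t ∈ Set.Ioc a b, ∀ {H : Type _} [NormedAddCommGroup H] [NormedSpace ℝ H] (w : ℝ → H),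
      ∫ s in t..b, w s = ∫ s, (Set.Ioi t).indicator w s ∂μ := by
    intro t ht H _ _ w
    rw [intervalIntegral.integral_of_le ht.2, integral_indicator measurableSet_Ioi, hμ,
      Measure.restrict_restrict measurableSet_Ioi]
    congr 2
    ext s
    simp only [Set.mem_Ioc, Set.mem_inter_iff, Set.mem_Ioi]
    exact ⟨fun h => ⟨h.1, ht.1.trans h.1, h.2⟩, fun h => ⟨h.1, h.2.2⟩⟩
  -- Both sides integrate over the triangle where the variable of `v` is below that of `u` (Fubini).
  -- The other summand is the opposite triangle, and together they fill the square.
  have hswap : ∫ t in a..b, B (∫ s in t..b, u s) (v t) = ∫ t in a..b, B (u t) (∫ s in a..t, v s) := by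
    rw [intervalIntegral.integral_of_le hab, intervalIntegral.integral_of_le hab]
    have e1 : ∫ t in Set.Ioc a b, B (∫ s in t..b, u s) (v t)
        = ∫ t, ∫ s, {z : ℝ × ℝ | z.2 < z.1}.indicator (fun z => B (u z.1) (v z.2)) (s, t) ∂μ ∂μ := by
      refine setIntegral_congr_fun measurableSet_Ioc fun t ht => ?_
      have h1 := (B.flip (v t)).integral_comp_comm ((hu.restrict (s := Set.Ioc a b)).indicator
        (measurableSet_Ioi (a := t)))
      simp only [ContinuousLinearMap.flip_apply] at h1
      rw [hI t ht, ← h1]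
      congr 1
      ext s
      by_cases hs : t < s <;> simp [Set.indicator, hs]
    have e2 : ∫ t in Set.Ioc a b, B (u t) (∫ s in a..t, v s)
        = ∫ t, ∫ s, {z : ℝ × ℝ | z.2 < z.1}.indicator (fun z => B (u z.1) (v z.2)) (t, s) ∂μ ∂μ := by
      refine setIntegral_congr_fun measurableSet_Ioc fun t ht => ?_
      have h1 := (B (u t)).integral_comp_comm ((hv.restrict (s := Set.Ioc a b)).indicator
        (measurableSet_Iio (a := t)))
      have h2 : ∫ s in a..t, v s = ∫ s, (Set.Iio t).indicator v s ∂μ := by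
        rw [intervalIntegral.integral_of_le ht.1.le, integral_indicator measurableSet_Iio, hμ,
          Measure.restrict_restrict measurableSet_Iio, integral_Ioc_eq_integral_Ioo]
        congr 2
        ext s
        simp only [Set.mem_Ioo, Set.mem_inter_iff, Set.mem_Iio, Set.mem_Ioc]
        exact ⟨fun h => ⟨h.2, h.1, h.2.le.trans ht.2⟩, fun h => ⟨h.2.1, h.1⟩⟩
      rw [h2, ← h1]
      congr 1
      ext s
      by_cases hs : s < t <;> simp [Set.indicator, hs]
    rw [e1, e2]
    exact (integral_integral_swap (f := fun t s =>
      {z : ℝ × ℝ | z.2 < z.1}.indicator (fun z => B (u z.1) (v z.2)) (t, s)) hf').symm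
  have hcu : Continuous fun t => ∫ s in t..b, u s := by
    refine ((intervalIntegral.continuous_primitive hu' b).neg).congr fun t => ?_
    exact (intervalIntegral.integral_symm _ _).symm
  have hcv : Continuous fun t => ∫ s in t..b, v s := by
    refine ((intervalIntegral.continuous_primitive hv' b).neg).congr fun t => ?_
    exact (intervalIntegral.integral_symm _ _).symm
  have hcv' : Continuous fun t => ∫ s in a..t, v s := intervalIntegral.continuous_primitive hv' a
  have hint : ∀ w : ℝ → F, Continuous w →
      IntervalIntegrable (fun t => B (u t) (w t)) volume a b := fun w hw => by
    obtain ⟨C, hC⟩ := (isCompact_uIcc (a := a) (b := b)).exists_bound_of_continuousOn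
      hw.continuousOn
    refine ((hu' a b).norm.const_mul (‖B‖ * C)).mono_fun ?_ ?_
    · exact B.aestronglyMeasurable_comp₂ (hu.1.restrict) hw.aestronglyMeasurable
    · filter_upwards [ae_restrict_mem measurableSet_uIoc] with t ht
      have h1 := hC t (Set.uIoc_subset_uIcc ht)
      have h2 := B.le_opNorm₂ (u t) (w t)
      have h3 : 0 ≤ C := (norm_nonneg _).trans h1
      rw [Real.norm_of_nonneg (by positivity)]
      calc _ ≤ ‖B‖ * ‖u t‖ * ‖w t‖ := h2
        _ ≤ ‖B‖ * ‖u t‖ * C := by gcongr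
        _ = _ := by ring
  have hint2 : IntervalIntegrable (fun t => B (∫ s in t..b, u s) (v t)) volume a b := by
    obtain ⟨C, hC⟩ := (isCompact_uIcc (a := a) (b := b)).exists_bound_of_continuousOn
      hcu.continuousOn
    refine ((hv' a b).norm.const_mul (‖B‖ * C)).mono_fun ?_ ?_
    · exact B.aestronglyMeasurable_comp₂ hcu.aestronglyMeasurable (hv.1.restrict)
    · filter_upwards [ae_restrict_mem measurableSet_uIoc] with t ht
      have h1 := hC t (Set.uIoc_subset_uIcc ht)
      have h2 := B.le_opNorm₂ (∫ s in t..b, u s) (v t)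
      have h3 : 0 ≤ C := (norm_nonneg _).trans h1
      rw [Real.norm_of_nonneg (by positivity)]
      calc _ ≤ ‖B‖ * ‖∫ s in t..b, u s‖ * ‖v t‖ := h2
        _ ≤ ‖B‖ * C * ‖v t‖ := by gcongr
  rw [intervalIntegral.integral_add (hint _ hcv) hint2, hswap,
    ← intervalIntegral.integral_add (hint _ hcv) (hint _ hcv')]
  have h3 : ∀ t, B (u t) (∫ s in t..b, v s) + B (u t) (∫ s in a..t, v s)
      = B.flip (∫ s in a..b, v s) (u t) := fun t => by
    rw [← map_add, add_comm, intervalIntegral.integral_add_adjacent_intervals (hv' _ _) (hv' _ _)]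
    rfl
  simp_rw [h3]
  rw [ContinuousLinearMap.intervalIntegral_comp_comm _ (hu' a b)]
  rfl

end IntegrationByParts

/-! ### Product rule and time reversal for histories. -/

section History

variable {n : ℕ}

theorem integral_lebesgueOn_eq {E : Type*} [NormedAddCommGroup E] [NormedSpace ℝ E] (f : ℝ → E) :
    ∫ θ, f θ ∂lebesgueOn (-1) 0 = ∫ θ in (-1 : ℝ)..0, f θ := by
  rw [intervalIntegral.integral_of_le (by norm_num), lebesgueOn, integral_Icc_eq_integral_Ioc]

theorem hist_eq_sub (e : M2 n) (θ : ℝ) : hist e θ = e.fst - ∫ s in θ..0, ext e.snd s := by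
  rw [hist, intervalIntegral.integral_symm]
  abel

theorem hist_toLp_eq_sub (a : Vec n) (g : L2 (-1) 0 n) (θ : ℝ) :
    hist (WithLp.toLp 2 (a, g)) θ = a - ∫ s in θ..0, ext g s := hist_eq_sub _ _

/-- Integration by parts in `H¹([-1, 0]; ℝⁿ)`. -/
theorem inner_snd_histL_add (e e' : M2 n) :
    ⟪e'.snd, histL e⟫ + ⟪histL e', e.snd⟫
      = ⟪e'.fst, e.fst⟫ - ⟪hist e' (-1), hist e (-1)⟫ := by
  have h1 : ∫ θ in (-1 : ℝ)..0, (⟪ext e'.snd θ, ∫ s in θ..0, ext e.snd s⟫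
      + ⟪∫ s in θ..0, ext e'.snd s, ext e.snd θ⟫)
        = ⟪∫ θ in (-1 : ℝ)..0, ext e'.snd θ, ∫ θ in (-1 : ℝ)..0, ext e.snd θ⟫ :=
    integral_bilin_primitive (innerSL ℝ (E := Vec n)) (integrable_ext e'.snd)
      (integrable_ext e.snd) (show (-1 : ℝ) ≤ 0 by norm_num)
  have hi : ∀ e : M2 n, IntervalIntegrable (ext e.snd) volume (-1) 0 := fun e =>
    (integrable_ext e.snd).intervalIntegrable
  rw [L2.inner_def, L2.inner_def, ← integral_add (L2.integrable_inner _ _)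
    (L2.integrable_inner _ _)]
  have h2 : ∫ θ, (⟪e'.snd θ, histL e θ⟫ + ⟪histL e' θ, e.snd θ⟫) ∂lebesgueOn (-1) 0
      = ∫ θ, ((⟪ext e'.snd θ, e.fst⟫ + ⟪e'.fst, ext e.snd θ⟫)
        - (⟪ext e'.snd θ, ∫ s in θ..0, ext e.snd s⟫ + ⟪∫ s in θ..0, ext e'.snd s, ext e.snd θ⟫))
          ∂lebesgueOn (-1) 0 := by
    refine integral_congr_ae ?_
    filter_upwards [coeFn_histL e, coeFn_histL e', ext_ae_eq e.snd, ext_ae_eq e'.snd]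
      with θ h1 h2 h3 h4
    rw [h1, h2, hist_eq_sub, hist_eq_sub, h3, h4, inner_sub_left, inner_sub_right]
    ring
  have hA : IntervalIntegrable (fun θ => ⟪ext e'.snd θ, e.fst⟫ + ⟪e'.fst, ext e.snd θ⟫)
      volume (-1) 0 :=
    (((integrable_ext e'.snd).inner_const e.fst).add
      ((integrable_ext e.snd).const_inner e'.fst)).intervalIntegrable
  have hB : IntervalIntegrable (fun θ => ⟪ext e'.snd θ, ∫ s in θ..0, ext e.snd s⟫
      + ⟪∫ s in θ..0, ext e'.snd s, ext e.snd θ⟫) volume (-1) 0 := by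
    have h5 : ∀ θ, (⟪ext e'.snd θ, e.fst⟫ + ⟪e'.fst, ext e.snd θ⟫)
        - (⟪ext e'.snd θ, hist e θ⟫ + ⟪hist e' θ, ext e.snd θ⟫)
        = ⟪ext e'.snd θ, ∫ s in θ..0, ext e.snd s⟫ + ⟪∫ s in θ..0, ext e'.snd s, ext e.snd θ⟫ := by
      intro θ
      rw [hist_eq_sub, hist_eq_sub, inner_sub_left, inner_sub_right]
      ring
    simp_rw [← h5]
    refine hA.sub ?_
    rw [intervalIntegrable_iff_integrableOn_Icc_of_le (by norm_num)]
    refine ((L2.integrable_inner e'.snd (histL e)).add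
      (L2.integrable_inner (histL e') e.snd)).congr ?_
    filter_upwards [coeFn_histL e, coeFn_histL e', ext_ae_eq e.snd, ext_ae_eq e'.snd]
      with θ h1 h2 h3 h4
    simp only [Pi.add_apply]
    rw [h1, h2, h3, h4]
  rw [h2, integral_lebesgueOn_eq, intervalIntegral.integral_sub hA hB, h1,
    intervalIntegral.integral_add ((integrable_ext e'.snd).inner_const e.fst).intervalIntegrable
      ((integrable_ext e.snd).const_inner e'.fst).intervalIntegrable]
  have h6 : ∫ θ in (-1 : ℝ)..0, ⟪e'.fst, ext e.snd θ⟫ = ⟪e'.fst, ∫ θ in (-1 : ℝ)..0, ext e.snd θ⟫ :=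
    (innerSL ℝ (E := Vec n) e'.fst).intervalIntegral_comp_comm (hi e)
  have h7 : ∫ θ in (-1 : ℝ)..0, ⟪ext e'.snd θ, e.fst⟫ = ⟪∫ θ in (-1 : ℝ)..0, ext e'.snd θ, e.fst⟫ := by
    simp_rw [fun θ => real_inner_comm e.fst (ext e'.snd θ), real_inner_comm e.fst]
    exact (innerSL ℝ (E := Vec n) e.fst).intervalIntegral_comp_comm (hi e')
  rw [h6, h7, hist_eq_sub, hist_eq_sub, inner_sub_left, inner_sub_right, inner_sub_right]
  ring

/-- The product of a function in `H¹` and an exponential function is in `H¹`. -/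
theorem exp_smul_hist (c : ℝ) (e : M2 n) {θ : ℝ} (hθ : θ ∈ Set.Icc (-1 : ℝ) 0) :
    Real.exp (c * θ) • hist e θ
      = hist (WithLp.toLp 2 (e.fst, mulExp c e.snd + c • mulExp c (histL e))) θ := by
  -- The derivative of the exponential, cut off so that it is integrable on the line; integration by
  -- parts applies to it and `φ'`.
  set u : ℝ → ℝ := (Set.Icc (-1 : ℝ) 0).indicator fun s => c * Real.exp (c * s) with hu
  have hcu : Continuous fun s : ℝ => c * Real.exp (c * s) := by fun_prop
  have huI : Integrable u := by
    rw [hu, integrable_indicator_iff measurableSet_Icc]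
    exact hcu.continuousOn.integrableOn_Icc
  have h1 := integral_bilin_primitive (ContinuousLinearMap.lsmul ℝ ℝ (E := Vec n)) huI
    (integrable_ext e.snd) hθ.2
  have hprim : ∀ t ∈ Set.Icc θ 0, ∫ s in t..0, u s = 1 - Real.exp (c * t) := by
    intro t ht
    have ht' : t ∈ Set.Icc (-1 : ℝ) 0 := ⟨hθ.1.trans ht.1, ht.2⟩
    have e1 : ∫ s in t..0, u s = ∫ s in t..0, c * Real.exp (c * s) :=
      intervalIntegral_ext ht' (by simp)
    have e2 : ∀ s ∈ Set.uIcc t 0, HasDerivAt (fun s => Real.exp (c * s)) (c * Real.exp (c * s)) s :=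
      fun s _ => by
        have := ((hasDerivAt_id s).const_mul c).exp
        simpa [mul_comm] using this
    rw [e1, intervalIntegral.integral_eq_sub_of_hasDerivAt e2 (hcu.intervalIntegrable _ _)]
    simp
  simp only [ContinuousLinearMap.lsmul_apply] at h1
  rw [hprim θ ⟨le_rfl, hθ.2⟩] at h1
  rw [hist_eq_sub, hist_toLp_eq_sub]
  have hi : IntervalIntegrable (ext e.snd) volume θ 0 := (integrable_ext e.snd).intervalIntegrable
  have hie : IntervalIntegrable (fun s => Real.exp (c * s) • ext e.snd s) volume θ 0 :=
    hi.continuousOn_smul (by fun_prop)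
  have hca : IntervalIntegrable (fun s => (c * Real.exp (c * s)) • e.fst) volume θ 0 :=
    (hcu.smul continuous_const).intervalIntegrable _ _
  have hcG : Continuous fun t => ∫ s in t..0, ext e.snd s := by
    refine (intervalIntegral.continuous_primitive
      (fun _ _ => (integrable_ext e.snd).intervalIntegrable) 0).neg.congr fun t => ?_
    exact (intervalIntegral.integral_symm _ _).symm
  have hcI : IntervalIntegrable (fun t => (c * Real.exp (c * t)) • ∫ s in t..0, ext e.snd s)
      volume θ 0 := (hcu.smul hcG).intervalIntegrable _ _
  have h2 : ∫ s in θ..0, ext ⇑(mulExp c e.snd + c • mulExp c (histL e)) s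
      = ∫ s in θ..0, ((c * Real.exp (c * s)) • e.fst + ext e.snd s
        - (u s • (∫ r in s..0, ext e.snd r) + (∫ r in s..0, u r) • ext e.snd s)) := by
    refine intervalIntegral.integral_congr_ae ?_
    filter_upwards [ext_add_ae (mulExp c e.snd) (c • mulExp c (histL e)),
      ext_smul_ae c (mulExp c (histL e)), ext_mulExp c (histL e), ext_mulExp c e.snd,
      ext_congr (coeFn_histL e)] with s h1 h2 h3 h4 h5 hs
    rw [Set.uIoc_of_le hθ.2] at hs
    have hs' : s ∈ Set.Icc (-1 : ℝ) 0 := ⟨hθ.1.trans hs.1.le, hs.2⟩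
    rw [h1, h2, h3, h4, h5, ext_of_mem (f := hist e) hs', hist_eq_sub, hprim s ⟨hs.1.le, hs.2⟩, hu,
      Set.indicator_of_mem hs']
    module
  have h3 : ∫ s in θ..0, (u s • (∫ r in s..0, ext e.snd r) + (∫ r in s..0, u r) • ext e.snd s)
      = (1 - Real.exp (c * θ)) • ∫ s in θ..0, ext e.snd s := h1
  have h4 : IntervalIntegrable (fun s => u s • (∫ r in s..0, ext e.snd r)
      + (∫ r in s..0, u r) • ext e.snd s) volume θ 0 := by
    refine (hcI.add (hi.sub hie)).congr fun s hs => ?_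
    rw [Set.uIoc_of_le hθ.2] at hs
    have hs' : s ∈ Set.Icc (-1 : ℝ) 0 := ⟨hθ.1.trans hs.1.le, hs.2⟩
    rw [hprim s ⟨hs.1.le, hs.2⟩, hu, Set.indicator_of_mem hs', sub_smul, one_smul]
  have h5 : ∫ s in θ..0, (c * Real.exp (c * s)) • e.fst = (1 - Real.exp (c * θ)) • e.fst := by
    rw [intervalIntegral.integral_smul_const, ← hprim θ ⟨le_rfl, hθ.2⟩]
    congr 1
    exact (intervalIntegral_ext hθ (by simp)).symm
  rw [h2, intervalIntegral.integral_sub (hca.add hi) h4, intervalIntegral.integral_add hca hi, h3,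
    h5]
  module

/-- The product rule in the coordinates of `H¹`. The product recurs on the right, inside its own
derivative, which is the form of a first order linear equation. -/
theorem mulExp_histL (c : ℝ) (e : M2 n) :
    mulExp c (histL e)
      = histL (WithLp.toLp 2 (e.fst, mulExp c e.snd + c • mulExp c (histL e))) := by
  refine Lp.ext ?_
  filter_upwards [coeFn_mulExp c (histL e), coeFn_histL e, coeFn_histL (WithLp.toLp 2
    (e.fst, mulExp c e.snd + c • mulExp c (histL e))), ae_restrict_mem measurableSet_Icc]
    with θ h1 h2 h3 h4
  rw [h1, h2, h3, exp_smul_hist c e h4]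

/-- The time reversal of a history. -/
def reverse (e : M2 n) : M2 n := WithLp.toLp 2 (hist e (-1), -reflect e.snd)

theorem hist_reverse (e : M2 n) (θ : ℝ) : hist (reverse e) θ = hist e (-1 - θ) := by
  have h1 : ∫ s in (0 : ℝ)..θ, ext ⇑(-reflect e.snd) s = ∫ s in (0 : ℝ)..θ, -ext e.snd (-1 - s) := by
    refine intervalIntegral.integral_congr_ae ?_
    filter_upwards [ext_neg_ae (reflect e.snd), ext_reflect e.snd] with s h1 h2 _
    rw [h1, h2]
  have h2 := hist_sub_hist e (-1 - θ) (-1)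
  change hist e (-1) + ∫ s in (0 : ℝ)..θ, ext ⇑(-reflect e.snd) s = _
  rw [h1, intervalIntegral.integral_neg,
    intervalIntegral.integral_comp_sub_left (fun s => ext e.snd s), sub_zero, ← h2]
  abel

theorem reflect_histL (e : M2 n) : reflect (histL e) = histL (reverse e) := by
  refine Lp.ext ?_
  filter_upwards [coeFn_reflect (histL e), coeFn_histL (reverse e),
    measurePreserving_reflect.quasiMeasurePreserving.ae_eq_comp (coeFn_histL e)] with θ h1 h2 h3
  rw [h1, h2, hist_reverse]
  exact h3

end History

/-! ### Matrix kernels as functionals and as multiplication operators. -/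

section Kernels

variable {n : ℕ}

/-- Matrix valued kernels in `L₂(-1, 0)`. -/
abbrev Kernel (n : ℕ) : Type := Lp (Vec n →L[ℝ] Vec n) 2 (lebesgueOn (-1) 0)

/-- The functional `g ↦ ∫_{-1}^0 A(θ) g(θ) dθ`. -/
def intK (A : Kernel n) : L2 (-1) 0 n →L[ℝ] Vec n :=
  (ContinuousLinearMap.id ℝ (Vec n →L[ℝ] Vec n)).lpPairing (lebesgueOn (-1) 0) 2 2 A

theorem intK_apply (A : Kernel n) (g : L2 (-1) 0 n) :
    intK A g = ∫ θ, A θ (g θ) ∂lebesgueOn (-1) 0 :=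
  ContinuousLinearMap.lpPairing_eq_integral _ _ _

theorem integrable_kernel_apply (A : Kernel n) (g : L2 (-1) 0 n) :
    Integrable (fun θ => A θ (g θ)) (lebesgueOn (-1) 0) :=
  memLp_one_iff_integrable.1
    ((ContinuousLinearMap.id ℝ (Vec n →L[ℝ] Vec n)).memLp_of_bilin 1 (Lp.memLp A) (Lp.memLp g))

/-- The multiplication operator `v ↦ A(·) v`. -/
def mulK (A : Kernel n) : Vec n →L[ℝ] L2 (-1) 0 n :=
  (ContinuousLinearMap.compLpL₂ 2 (lebesgueOn (-1) 0)
    (ContinuousLinearMap.apply ℝ (Vec n) : Vec n →L[ℝ] (Vec n →L[ℝ] Vec n) →L[ℝ] Vec n)).flip A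

theorem coeFn_mulK (A : Kernel n) (v : Vec n) :
    mulK A v =ᵐ[lebesgueOn (-1) 0] fun θ => A θ v :=
  ContinuousLinearMap.coeFn_compLpL _ _

theorem reflect_mulK (A : Kernel n) (v : Vec n) : reflect (mulK A v) = mulK (reflect A) v := by
  refine Lp.ext ?_
  filter_upwards [coeFn_reflect (mulK A v), coeFn_mulK (reflect A) v, coeFn_reflect A,
    measurePreserving_reflect.quasiMeasurePreserving.ae_eq_comp (coeFn_mulK A v)] with θ h1 h2 h3 h4
  rw [h1, h2, h3]
  exact h4

theorem intK_reflect (A : Kernel n) (g : L2 (-1) 0 n) :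
    intK (reflect A) g = intK A (reflect g) := by
  have h0 := measurePreserving_reflect.integral_comp
    (Homeomorph.subLeft (-1 : ℝ)).measurableEmbedding (fun θ => A θ (reflect g θ))
  rw [intK_apply, intK_apply, ← h0]
  refine integral_congr_ae ?_
  filter_upwards [coeFn_reflect A, measurePreserving_reflect.quasiMeasurePreserving.ae_eq_comp
    (coeFn_reflect g)] with θ h1 h2
  simp only [Function.comp_apply] at h2
  rw [h1, h2, sub_sub_cancel]

theorem inner_intK {A A' : Kernel n}
    (h : ∀ᵐ θ ∂lebesgueOn (-1) 0, ∀ v w, ⟪A' θ v, w⟫ = ⟪v, A θ w⟫) (g : L2 (-1) 0 n) (w : Vec n) :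
    ⟪intK A' g, w⟫ = ⟪g, mulK A w⟫ := by
  rw [intK_apply, L2.inner_def, real_inner_comm, ← integral_inner (integrable_kernel_apply A' g)]
  refine integral_congr_ae ?_
  filter_upwards [h, coeFn_mulK A w] with θ h1 h2
  rw [h2, real_inner_comm, h1]

end Kernels

/-! ### Quasi-dissipativity and the resolvent of the neutral operator. -/

section Generation

variable {n : ℕ} {V : Type*} [NormedAddCommGroup V] [NormedSpace ℝ V]

/-- The operator with the given components in `M₂`. -/
def pairL (f : V →L[ℝ] Vec n) (g : V →L[ℝ] L2 (-1) 0 n) : V →L[ℝ] M2 n :=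
  (WithLp.prodContinuousLinearEquiv 2 ℝ (Vec n) (L2 (-1) 0 n)).symm.toContinuousLinearMap.comp
    (f.prod g)

@[simp] theorem pairL_apply (f : V →L[ℝ] Vec n) (g : V →L[ℝ] L2 (-1) 0 n) (x : V) :
    pairL f g x = WithLp.toLp 2 (f x, g x) := rfl

/-- The projections of `M₂` onto its components. -/
def fstM : M2 n →L[ℝ] Vec n := WithLp.fstL 2 ℝ (Vec n) (L2 (-1) 0 n)

/-- The second projection. -/
def sndM : M2 n →L[ℝ] L2 (-1) 0 n := WithLp.sndL 2 ℝ (Vec n) (L2 (-1) 0 n)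

@[simp] theorem fstM_apply (x : M2 n) : fstM x = x.fst := rfl

@[simp] theorem sndM_apply (x : M2 n) : sndM x = x.snd := rfl

theorem M2_ext {x y : M2 n} (h1 : x.fst = y.fst) (h2 : x.snd = y.snd) : x = y := by
  change WithLp.toLp 2 (x.fst, x.snd) = WithLp.toLp 2 (y.fst, y.snd)
  rw [h1, h2]

/-- The embedding `φ ↦ (φ(0) - A₁ φ(-1), φ)` of `H¹` in `M₂`. -/
def embed (A₁ : Vec n →L[ℝ] Vec n) : M2 n →L[ℝ] M2 n :=
  pairL (fstM - A₁.comp (evalL (-1))) histL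

/-- The map `φ ↦ (∫ (A₂ φ' + A₃ φ), φ')`. -/
def action (A₂ A₃ : Kernel n) : M2 n →L[ℝ] M2 n :=
  pairL ((intK A₂).comp sndM + (intK A₃).comp histL) sndM

theorem embed_apply (A₁ : Vec n →L[ℝ] Vec n) (e : M2 n) :
    embed A₁ e = WithLp.toLp 2 (e.fst - A₁ (hist e (-1)), histL e) := rfl

theorem action_apply (A₂ A₃ : Kernel n) (e : M2 n) :
    action A₂ A₃ e = WithLp.toLp 2 (intK A₂ e.snd + intK A₃ (histL e), e.snd) := rfl

theorem embed_injective (A₁ : Vec n →L[ℝ] Vec n) : Function.Injective (embed A₁) :=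
  (injective_iff_map_eq_zero _).2 fun e he => by
    refine eq_zero_of_histL_eq_zero ?_
    exact congrArg WithLp.snd he

/-- The similarity `(v, f) ↦ (v - ∫ A₂ f, e^{-cθ} f)`. -/
def weight (A₂ : Kernel n) (c : ℝ) : M2 n ≃L[ℝ] M2 n :=
  ContinuousLinearEquiv.equivOfInverse
    (pairL (fstM - (intK A₂).comp sndM) ((mulExp (-c)).comp sndM))
    (pairL (fstM + ((intK A₂).comp (mulExp c)).comp sndM) ((mulExp c).comp sndM))
    (fun x => by
      refine M2_ext ?_ ?_ <;> simp [mulExp_mulExp_neg])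
    (fun x => by
      have h := mulExp_mulExp_neg (-c) x.snd
      rw [neg_neg] at h
      refine M2_ext ?_ ?_ <;> simp [h])

theorem weight_apply (A₂ : Kernel n) (c : ℝ) (x : M2 n) :
    weight A₂ c x = WithLp.toLp 2 (x.fst - intK A₂ x.snd, mulExp (-c) x.snd) := rfl

/-- The operator of the neutral type system is quasi-dissipative in an equivalent inner product. -/
theorem exists_quasidissipative (A₁ : Vec n →L[ℝ] Vec n) (A₂ A₃ : Kernel n) :
    ∃ c ω : ℝ, ∀ e, ⟪weight A₂ c (action A₂ A₃ e), weight A₂ c (embed A₁ e)⟫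
      ≤ ω * ‖weight A₂ c (embed A₁ e)‖ ^ 2 := by
  -- This choice gives `e^{2c} ≥ 1 + 2c ≥ 2 ‖A₁‖ ^ 2`, so the weighted boundary term at `-1` absorbs
  -- the contribution of `A₁ φ(-1)` to `‖φ(0)‖ ^ 2`.
  set c := ‖A₁‖ ^ 2 with hc
  set k := ‖(mulExp c : L2 (-1) 0 n →L[ℝ] L2 (-1) 0 n)‖ with hk
  have hk0 : 0 ≤ k := norm_nonneg _
  refine ⟨c, c + 2 + 2 * (‖intK A₂‖ * k) ^ 2 + ‖intK A₃‖ * k, fun e => ?_⟩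
  set p := mulExp (-c) (histL e) with hp
  set q : M2 n := WithLp.toLp 2 (e.fst, mulExp (-c) e.snd + (-c) • p) with hq
  set w := e.fst - A₁ (hist e (-1)) - intK A₂ (histL e) with hw
  have hpq : p = histL q := mulExp_histL (-c) e
  have hq1 : hist q (-1) = Real.exp c • hist e (-1) := by
    have := exp_smul_hist (-c) e (θ := -1) (by simp)
    rw [hq, hp, ← this]
    simp
  have hpe : ‖histL e‖ ≤ k * ‖p‖ := by
    have h1 : histL e = mulExp c p := (mulExp_mulExp_neg c (histL e)).symm
    rw [h1]
    exact (mulExp c).le_opNorm p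
  -- The weight cancels `∫ A₂ φ'`, the one term of the first component that the norm of `φ` does not
  -- control.
  have hJ1 : weight A₂ c (action A₂ A₃ e)
      = WithLp.toLp 2 (intK A₃ (histL e), mulExp (-c) e.snd) := by
    simp [weight_apply, action_apply]
  have hJ2 : weight A₂ c (embed A₁ e) = WithLp.toLp 2 (w, p) := by
    simp [weight_apply, embed_apply, hw, hp]
  -- Here `q` represents `e^{-cθ} φ`, and the identity reads `2 ⟪q', q⟫ = ‖φ(0)‖ ^ 2 - e^{2c}
  -- ‖φ(-1)‖ ^ 2`.
  have hibp := inner_snd_histL_add q q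
  rw [real_inner_comm (q.snd) (histL q), ← hpq, real_inner_self_eq_norm_sq,
    real_inner_self_eq_norm_sq, hq1, norm_smul, Real.norm_of_nonneg (Real.exp_pos _).le] at hibp
  have hq2 : q.snd = mulExp (-c) e.snd + (-c) • p := rfl
  have hq3 : q.fst = e.fst := rfl
  have hin : ⟪mulExp (-c) e.snd, p⟫ = ⟪q.snd, p⟫ + c * ‖p‖ ^ 2 := by
    rw [hq2, inner_add_left, inner_smul_left, real_inner_self_eq_norm_sq]
    simp
  rw [hJ1, hJ2, WithLp.prod_inner_apply, WithLp.prod_norm_sq_eq_of_L2]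
  change ⟪intK A₃ (histL e), w⟫ + ⟪mulExp (-c) e.snd, p⟫ ≤ _ * (‖w‖ ^ 2 + ‖p‖ ^ 2)
  rw [hin]
  rw [hq3] at hibp
  have h1 : ‖e.fst‖ ≤ ‖A₁‖ * ‖hist e (-1)‖ + (‖w‖ + ‖intK A₂‖ * k * ‖p‖) := by
    have : e.fst = A₁ (hist e (-1)) + (w + intK A₂ (histL e)) := by rw [hw]; abel
    rw [this]
    refine (norm_add_le _ _).trans (add_le_add (A₁.le_opNorm _) ((norm_add_le _ _).trans ?_))
    gcongr
    refine ((intK A₂).le_opNorm _).trans ?_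
    rw [mul_assoc]
    gcongr
  have h2 : ⟪intK A₃ (histL e), w⟫ ≤ ‖intK A₃‖ * k * (‖w‖ ^ 2 + ‖p‖ ^ 2) := by
    calc _ ≤ ‖intK A₃ (histL e)‖ * ‖w‖ := real_inner_le_norm _ _
      _ ≤ (‖intK A₃‖ * (k * ‖p‖)) * ‖w‖ := by
        gcongr
        exact ((intK A₃).le_opNorm _).trans (by gcongr)
      _ = ‖intK A₃‖ * k * (‖p‖ * ‖w‖) := by ring
      _ ≤ _ := by
        gcongr
        nlinarith [sq_nonneg (‖p‖ - ‖w‖), sq_nonneg ‖p‖, sq_nonneg ‖w‖]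
  have h3 : 2 * ‖A₁‖ ^ 2 ≤ Real.exp c ^ 2 := by
    have h4 := Real.add_one_le_exp (c + c)
    rw [Real.exp_add] at h4
    nlinarith
  have h5 : ‖e.fst‖ ^ 2 ≤ 2 * (‖A₁‖ * ‖hist e (-1)‖) ^ 2
      + 4 * (‖w‖ ^ 2 + (‖intK A₂‖ * k) ^ 2 * ‖p‖ ^ 2) := by
    set x := ‖A₁‖ * ‖hist e (-1)‖
    set y := ‖intK A₂‖ * k * ‖p‖ with hy
    have : ‖e.fst‖ ^ 2 ≤ (x + (‖w‖ + y)) ^ 2 := by gcongr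
    have e1 : (‖intK A₂‖ * k) ^ 2 * ‖p‖ ^ 2 = y ^ 2 := by rw [hy]; ring
    rw [e1]
    nlinarith [sq_nonneg (x - (‖w‖ + y)), sq_nonneg (‖w‖ - y)]
  have h6 : 2 * (‖A₁‖ * ‖hist e (-1)‖) ^ 2 ≤ (Real.exp c * ‖hist e (-1)‖) ^ 2 := by
    rw [mul_pow, mul_pow, ← mul_assoc]
    gcongr
  have h7 : ⟪q.snd, p⟫ ≤ 2 * (‖w‖ ^ 2 + (‖intK A₂‖ * k) ^ 2 * ‖p‖ ^ 2) := by
    linarith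
  have h8 : 0 ≤ c * ‖w‖ ^ 2 + 2 * ‖p‖ ^ 2 + 2 * ((‖intK A₂‖ * k) ^ 2 * ‖w‖ ^ 2) := by positivity
  linarith

/-- Variation of constants: `φ(θ) = e^{lθ} (a - ∫₀^θ e^{-ls} h)` solves `l φ - φ' = h` with `φ(0) =
a`. -/
theorem histL_resolvent (l : ℝ) (a : Vec n) (h : L2 (-1) 0 n) :
    histL (WithLp.toLp 2 (a, l • mulExp l (histL (WithLp.toLp 2 (a, -mulExp (-l) h))) - h))
      = mulExp l (histL (WithLp.toLp 2 (a, -mulExp (-l) h))) := by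
  set P := mulExp l (histL (WithLp.toLp 2 (a, -mulExp (-l) h)))
  have hP : P = histL (WithLp.toLp 2 (a, mulExp l (-mulExp (-l) h) + l • P)) :=
    mulExp_histL l (WithLp.toLp 2 (a, -mulExp (-l) h))
  rw [map_neg, mulExp_mulExp_neg, neg_add_eq_sub] at hP
  exact hP.symm

theorem injective_of_quasidissipative {X E : Type*} [NormedAddCommGroup X] [InnerProductSpace ℝ X]
    [AddCommGroup E] [Module ℝ E] (J : X ≃L[ℝ] X) (ι Λ : E →ₗ[ℝ] X) {ω l : ℝ}
    (hι : Function.Injective ι) (hdiss : ∀ e, ⟪J (Λ e), J (ι e)⟫ ≤ ω * ‖J (ι e)‖ ^ 2) (hl : ω < l) :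
    Function.Injective (l • ι - Λ) :=
  (injective_iff_map_eq_zero _).2 fun e he => by
    rw [LinearMap.sub_apply, LinearMap.smul_apply, sub_eq_zero] at he
    have h1 := hdiss e
    rw [← he, map_smul, inner_smul_left, real_inner_self_eq_norm_sq] at h1
    simp only [conj_trivial] at h1
    have h2 : ‖J (ι e)‖ ^ 2 = 0 := by nlinarith [sq_nonneg ‖J (ι e)‖]
    simpa [map_eq_zero_iff ι hι] using h2

/-- The `L₂` component of the equation is solvable for every initial value `a`. The first component
is then a linear equation for `a` in `ℝⁿ`, where injectivity implies surjectivity. -/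
theorem surjective_resolvent (A₁ : Vec n →L[ℝ] Vec n) (A₂ A₃ : Kernel n) {l : ℝ}
    (hinj : Function.Injective (l • embed A₁ - action A₂ A₃)) :
    Function.Surjective (l • embed A₁ - action A₂ A₃) := by
  -- The coordinates of the homogeneous solution `e^{lθ} a`.
  set N : Vec n →L[ℝ] M2 n := pairL (ContinuousLinearMap.id ℝ _)
    ((l • (mulExp l).comp histL).comp (pairL (ContinuousLinearMap.id ℝ _) 0)) with hN
  set K := l • embed A₁ - action A₂ A₃ with hK
  have hsnd : ∀ e, (K e).snd = l • histL e - e.snd := fun e => rfl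
  have hN0 : ∀ a, (K (N a)).snd = 0 := fun a => by
    have h1 := histL_resolvent l a 0
    rw [map_zero, neg_zero, sub_zero] at h1
    have h2 : N a = WithLp.toLp 2 (a, l • mulExp l (histL (WithLp.toLp 2 (a, 0)))) := rfl
    rw [hsnd, h2, h1]
    exact sub_self _
  have hDinj : Function.Injective ((fstM.comp (K.comp N)).toLinearMap) := by
    refine (injective_iff_map_eq_zero _).2 fun a ha => ?_
    have h1 : K (N a) = 0 := M2_ext ha (hN0 a)
    have h2 : N a = 0 := (map_eq_zero_iff K hinj).1 h1
    exact congrArg WithLp.fst h2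
  have hDsurj := LinearMap.surjective_of_injective hDinj
  intro x
  -- The particular solution with value `0` at `0`.
  set e₁ : M2 n := WithLp.toLp 2 (0, l • mulExp l (histL (WithLp.toLp 2
    ((0 : Vec n), -mulExp (-l) x.snd))) - x.snd) with he₁
  have h1 : (K e₁).snd = x.snd := by
    rw [hsnd, he₁, histL_resolvent]
    change _ - (_ - _) = _
    abel
  obtain ⟨a, ha⟩ := hDsurj (x.fst - (K e₁).fst)
  refine ⟨N a + e₁, ?_⟩
  rw [map_add]
  refine M2_ext ?_ ?_
  · rw [WithLp.add_fst]
    have : (K (N a)).fst = x.fst - (K e₁).fst := ha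
    rw [this, sub_add_cancel]
  · rw [WithLp.add_snd, hN0, h1, zero_add]

/-- Generation of a `C₀`-semigroup, and invertibility of `λ - 𝒜` for large `λ`. -/
theorem exists_isGeneratedBy (A₁ : Vec n →L[ℝ] Vec n) (A₂ A₃ : Kernel n) :
    Dense (Set.range (embed A₁)) ∧
      (∃ S, IsGeneratedBy S (Set.range fun e => (embed A₁ e, action A₂ A₃ e))) ∧
      ∃ l : ℝ, Function.Bijective (l • embed A₁ - action A₂ A₃) := by
  obtain ⟨c, ω, hω⟩ := exists_quasidissipative A₁ A₂ A₃
  have hinj : ∀ l > ω, Function.Injective (l • embed A₁ - action A₂ A₃) := fun l hl =>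
    injective_of_quasidissipative (weight A₂ c) (embed A₁).toLinearMap (action A₂ A₃).toLinearMap
      (embed_injective A₁) hω hl
  obtain ⟨h1, h2⟩ := exists_isGeneratedBy_of_dissipative (weight A₂ c) (embed A₁).toLinearMap
    (action A₂ A₃).toLinearMap ω (embed_injective A₁) hω
    fun l hl => surjective_resolvent A₁ A₂ A₃ (hinj l hl)
  exact ⟨h1, h2, ω + 1, hinj _ (lt_add_one ω), surjective_resolvent A₁ A₂ A₃ (hinj _ (lt_add_one ω))⟩

end Generation

/-! ### Convolutions with matrix kernels and Volterra equations. -/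

section Convolution

variable {n : ℕ}

/-- The convolution of a kernel and a function, both extended by zero. -/
def conv (A : Kernel n) (h : L2 (-1) 0 n) (θ : ℝ) : Vec n := ∫ σ, ext A σ (ext h (θ - σ))

theorem memLp_ext_sub (h : L2 (-1) 0 n) (θ : ℝ) : MemLp (fun σ => ext h (θ - σ)) 2 volume :=
  (memLp_ext h).comp_measurePreserving (Measure.measurePreserving_sub_left volume θ)

theorem eLpNorm_ext {E : Type*} [NormedAddCommGroup E] (f : Lp E 2 (lebesgueOn (-1) 0)) :
    eLpNorm (ext f) 2 volume = ‖f‖ₑ := by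
  rw [ext, eLpNorm_indicator_eq_eLpNorm_restrict measurableSet_Icc, Lp.enorm_def]

theorem integrable_conv (A : Kernel n) (h : L2 (-1) 0 n) (θ : ℝ) :
    Integrable fun σ => ext A σ (ext h (θ - σ)) :=
  memLp_one_iff_integrable.1 ((ContinuousLinearMap.id ℝ (Vec n →L[ℝ] Vec n)).memLp_of_bilin 1
    (memLp_ext A) (memLp_ext_sub h θ))

/-- Cauchy–Schwarz, uniformly in `θ` because `σ ↦ θ - σ` preserves the measure. A kernel of small
norm thus gives a small operator. -/
theorem norm_conv_le (A : Kernel n) (h : L2 (-1) 0 n) (θ : ℝ) :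
    ‖conv A h θ‖ ≤ ‖A‖ * ‖h‖ := by
  have h1 := eLpNorm_le_eLpNorm_mul_eLpNorm_of_nnnorm (p := 2) (q := 2) (r := 1) (memLp_ext A).1
    (memLp_ext_sub h θ).1 (fun T v => T v) 1 (Eventually.of_forall fun σ => by
      simpa using (ext A σ).le_opNNNorm (ext h (θ - σ)))
  have h2 : eLpNorm (fun σ => ext h (θ - σ)) 2 volume = ‖h‖ₑ := by
    rw [← eLpNorm_ext h]
    exact eLpNorm_comp_measurePreserving (memLp_ext h).1
      (Measure.measurePreserving_sub_left volume θ)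
  rw [h2, eLpNorm_ext, eLpNorm_one_eq_lintegral_enorm] at h1
  have h3 : ‖conv A h θ‖ₑ ≤ ‖A‖ₑ * ‖h‖ₑ := by
    refine (enorm_integral_le_lintegral_enorm _).trans (h1.trans ?_)
    simp
  have h4 := ENNReal.toReal_mono (by finiteness) h3
  rwa [ENNReal.toReal_mul, toReal_enorm, toReal_enorm, toReal_enorm] at h4

theorem memLp_conv (A : Kernel n) (h : L2 (-1) 0 n) : MemLp (conv A h) 2 (lebesgueOn (-1) 0) := by
  refine MemLp.of_bound ?_ (‖A‖ * ‖h‖) (Eventually.of_forall fun θ => norm_conv_le A h θ)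
  exact ((integrable_ext A).integrable_convolution
    (ContinuousLinearMap.id ℝ (Vec n →L[ℝ] Vec n)) (integrable_ext h)).1.restrict

theorem ae_comp_sub {p : ℝ → Prop} (h : ∀ᵐ s, p s) (θ : ℝ) : ∀ᵐ σ, p (θ - σ) :=
  (Measure.measurePreserving_sub_left volume θ).quasiMeasurePreserving.ae h

/-- The convolution operator with a matrix valued kernel. -/
def convK (A : Kernel n) : L2 (-1) 0 n →L[ℝ] L2 (-1) 0 n :=
  LinearMap.mkContinuous
    { toFun := fun h => (memLp_conv A h).toLp
      map_add' := fun h k => by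
        rw [← MemLp.toLp_add]
        refine MemLp.toLp_congr _ _ (Eventually.of_forall fun θ => ?_)
        rw [Pi.add_apply, conv, conv, conv, ← integral_add (integrable_conv A h θ)
          (integrable_conv A k θ)]
        refine integral_congr_ae ?_
        filter_upwards [ae_comp_sub (ext_add_ae h k) θ] with σ hσ
        rw [hσ, map_add]
      map_smul' := fun c h => by
        rw [RingHom.id_apply, ← MemLp.toLp_const_smul]
        refine MemLp.toLp_congr _ _ (Eventually.of_forall fun θ => ?_)
        rw [Pi.smul_apply, conv, conv, ← integral_smul]
        refine integral_congr_ae ?_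
        filter_upwards [ae_comp_sub (ext_smul_ae c h) θ] with σ hσ
        rw [hσ, map_smul] } ‖A‖
    fun h => by
      have h := Lp.norm_le_of_ae_bound (f := (memLp_conv A h).toLp) (C := ‖A‖ * ‖h‖) (by positivity)
        (by
          filter_upwards [(memLp_conv A h).coeFn_toLp] with θ hθ
          rw [hθ]
          exact norm_conv_le A h θ)
      simpa [measureUnivNNReal] using h

theorem norm_convK_le (A : Kernel n) : ‖convK A‖ ≤ ‖A‖ :=
  LinearMap.mkContinuous_norm_le _ (norm_nonneg _) _

theorem coeFn_convK (A : Kernel n) (h : L2 (-1) 0 n) :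
    convK A h =ᵐ[lebesgueOn (-1) 0] conv A h :=
  (memLp_conv A h).coeFn_toLp

/-- Since `e^{cθ} = e^{cσ} e^{c(θ-σ)}`, an exponential weight distributes over the two factors. -/
theorem mulExp_convK (c : ℝ) (A : Kernel n) (h : L2 (-1) 0 n) :
    mulExp c (convK A h) = convK (mulExp c A) (mulExp c h) := by
  refine Lp.ext ?_
  filter_upwards [coeFn_mulExp c (convK A h), coeFn_convK A h,
    coeFn_convK (mulExp c A) (mulExp c h)] with θ h1 h2 h3
  rw [h1, h2, h3, conv, conv, ← integral_smul]
  refine integral_congr_ae ?_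
  filter_upwards [ext_mulExp c A, ae_comp_sub (ext_mulExp c h) θ] with σ h4 h5
  rw [h4, h5, smul_apply, map_smul, smul_smul, ← Real.exp_add]
  congr 2
  ring

/-- At `θ = -1` the variable `σ` runs through all of `[-1, 0]`; the full delay functional appears as
a boundary value. -/
theorem conv_neg_one (A : Kernel n) (f : L2 (-1) 0 n) : conv A f (-1) = intK A (reflect f) := by
  rw [intK_apply, conv, ← integral_indicator measurableSet_Icc]
  refine integral_congr_ae ?_
  filter_upwards [ext_reflect f] with σ h1
  by_cases h2 : σ ∈ Set.Icc (-1 : ℝ) 0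
  · rw [Set.indicator_of_mem h2, ext_of_mem h2, ← h1, ext_of_mem h2]
  · rw [Set.indicator_of_notMem h2, ext_of_notMem h2]
    simp

theorem integrable_ext_apply_hist (A : Kernel n) (e : M2 n) (θ : ℝ) :
    Integrable fun σ => ext A σ (hist e (θ - σ)) :=
  (ContinuousLinearMap.id ℝ (Vec n →L[ℝ] Vec n)).integrable_of_bilin_of_bdd_right (2 * ‖e‖)
    (integrable_ext A) ((continuous_hist e).comp (by fun_prop)).aestronglyMeasurable
    (Eventually.of_forall fun σ => norm_hist_le e _)

theorem integrable_ext_apply (A : Kernel n) (v : Vec n) : Integrable fun σ => ext A σ v :=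
  (integrable_ext A).apply_continuousLinearMap v

/-- Fubini. It matters that `hist` is extended by constants: it is then a primitive of the extended
derivative on the whole line. -/
theorem integral_conv (A : Kernel n) (e : M2 n) (θ : ℝ) :
    ∫ s in (0 : ℝ)..θ, conv A e.snd s
      = (∫ σ, ext A σ (hist e (θ - σ))) - ∫ σ, ext A σ (hist e (0 - σ)) := by
  have h1 : Integrable (fun z : ℝ × ℝ => ext A z.2 (ext e.snd (z.1 - z.2)))
      (volume.prod volume) :=
    (integrable_ext A).convolution_integrand (ContinuousLinearMap.id ℝ (Vec n →L[ℝ] Vec n))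
      (integrable_ext e.snd)
  rw [← integral_sub (integrable_ext_apply_hist A e θ) (integrable_ext_apply_hist A e 0)]
  simp only [conv]
  rw [intervalIntegral_integral_swap]
  · refine integral_congr_ae (Eventually.of_forall fun σ => ?_)
    simp only
    rw [← map_sub, hist_sub_hist, ← intervalIntegral.integral_comp_sub_right (ext e.snd) σ]
    exact (ext A σ).intervalIntegral_comp_comm
      ((integrable_ext e.snd).comp_sub_right σ).intervalIntegrable
  · refine h1.mono_measure ?_
    exact Measure.prod_mono Measure.restrict_le_self le_rfl

/-- The extensions of `φ` by zero, in `conv`, and by constants, in `hist`, matter differently only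
for `σ < θ`. This jump of size `φ(0)` yields the term `-A φ(0)` in the derivative. -/
theorem conv_histL (A : Kernel n) (e : M2 n) {θ : ℝ} (hθ : θ ∈ Set.Icc (-1 : ℝ) 0) :
    conv A (histL e) θ = hist (WithLp.toLp 2 (0, convK A e.snd - mulK A e.fst)) θ := by
  have hA : Integrable fun σ => ext A σ e.fst := integrable_ext_apply A e.fst
  have h1 : conv A (histL e) θ
      = ∫ σ, (ext A σ (hist e (θ - σ)) - (Set.Iio θ).indicator (fun σ => ext A σ e.fst) σ) := by
    refine integral_congr_ae ?_
    filter_upwards [ae_comp_sub (ext_congr (coeFn_histL e)) θ] with σ hσ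
    rw [hσ]
    by_cases hs : σ ∈ Set.Icc (-1 : ℝ) 0
    swap
    · rw [ext_of_notMem hs]
      by_cases h2 : σ ∈ Set.Iio θ
      · rw [Set.indicator_of_mem h2, ext_of_notMem hs]; simp
      · rw [Set.indicator_of_notMem h2]; simp
    by_cases h2 : σ ∈ Set.Iio θ
    · have h2' : σ < θ := h2
      rw [Set.indicator_of_mem h2, hist_of_nonneg e (by linarith), sub_self,
        ext_of_notMem (f := hist e) (s := θ - σ) fun h3 => by linarith [h3.2], map_zero]
    · have h2' : θ ≤ σ := not_lt.1 h2
      rw [Set.indicator_of_notMem h2, sub_zero, ext_of_mem (f := hist e)]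
      exact ⟨by linarith [hθ.1, hs.2], by linarith⟩
  have h2 : ∫ σ, ext A σ (hist e (0 - σ)) = ∫ σ, ext A σ e.fst := by
    refine integral_congr_ae (Eventually.of_forall fun σ => ?_)
    by_cases hs : σ ∈ Set.Icc (-1 : ℝ) 0
    · simp only
      rw [hist_of_nonneg e (by linarith [hs.2])]
    · simp only
      rw [ext_of_notMem hs]
      simp
  have h3 : ∫ σ, ext A σ e.fst = (∫ σ in Set.Iio θ, ext A σ e.fst) + ∫ σ in θ..0, ext A σ e.fst := by
    rw [intervalIntegral.integral_of_le hθ.2, ← integral_Iic_eq_integral_Iio,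
      ← setIntegral_union (Set.Iic_disjoint_Ioc le_rfl) measurableSet_Ioc hA.integrableOn
        hA.integrableOn, Set.Iic_union_Ioc_eq_Iic hθ.2, setIntegral_eq_integral_of_forall_compl_eq_zero]
    intro σ hσ
    rw [ext_of_notMem]
    · simp
    · intro h4
      exact hσ h4.2
  have h4 : ∫ s in (0 : ℝ)..θ, ext ⇑(convK A e.snd - mulK A e.fst) s
      = (∫ s in (0 : ℝ)..θ, conv A e.snd s) - ∫ s in (0 : ℝ)..θ, ext A s e.fst := by
    rw [← intervalIntegral.integral_sub]
    · have h5 : ext ⇑(convK A e.snd - mulK A e.fst) =ᵐ[volume]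
          ext fun s => conv A e.snd s - ext A s e.fst := by
        refine ext_congr ?_
        filter_upwards [Lp.coeFn_sub (convK A e.snd) (mulK A e.fst), coeFn_convK A e.snd,
          coeFn_mulK A e.fst, ext_ae_eq A] with s h1 h2 h3 h4
        rw [h1, Pi.sub_apply, h2, h3, h4]
      rw [intervalIntegral.integral_congr_ae (h5.mono fun s hs _ => hs)]
      exact intervalIntegral_ext (by simp) hθ
    · exact ((integrable_ext A).integrable_convolution
        (ContinuousLinearMap.id ℝ (Vec n →L[ℝ] Vec n)) (integrable_ext e.snd)).intervalIntegrable
    · exact hA.intervalIntegrable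
  change _ = 0 + ∫ s in (0 : ℝ)..θ, ext ⇑(convK A e.snd - mulK A e.fst) s
  rw [h4, h1, integral_sub (integrable_ext_apply_hist A e θ) (hA.indicator measurableSet_Iio),
    integral_indicator measurableSet_Iio, integral_conv, h2, h3, intervalIntegral.integral_symm]
  abel

/-- Differentiation of the convolution with a function in `H¹`. -/
theorem convK_histL (A : Kernel n) (e : M2 n) :
    convK A (histL e) = histL (WithLp.toLp 2 (0, convK A e.snd - mulK A e.fst)) := by
  refine Lp.ext ?_
  filter_upwards [coeFn_convK A (histL e), coeFn_histL (WithLp.toLp 2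
    (0, convK A e.snd - mulK A e.fst)), ae_restrict_mem measurableSet_Icc] with θ h1 h2 h3
  rw [h1, h2, conv_histL A e h3]

theorem hist_convK_neg_one (A : Kernel n) (e : M2 n) :
    hist (WithLp.toLp 2 (0, convK A e.snd - mulK A e.fst)) (-1) = intK A (reflect (histL e)) := by
  rw [← conv_histL A e (by simp), conv_neg_one]

/-- The constant kernel `1`. -/
def oneK (n : ℕ) : Kernel n :=
  (memLp_const (ContinuousLinearMap.id ℝ (Vec n)) : MemLp _ 2 (lebesgueOn (-1) 0)).toLp

/-- Integration from `0` is a convolution as well, so exponential weights treat both terms of the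
Volterra equation alike. -/
theorem histL_zero_eq (h : L2 (-1) 0 n) : histL (WithLp.toLp 2 (0, h)) = -convK (oneK n) h := by
  refine Lp.ext ?_
  filter_upwards [coeFn_histL (WithLp.toLp 2 ((0 : Vec n), h)), Lp.coeFn_neg (convK (oneK n) h),
    coeFn_convK (oneK n) h, ae_restrict_mem measurableSet_Icc] with θ h1 h2 h3 hθ
  rw [h1, h2, Pi.neg_apply, h3, hist_toLp_eq_sub, zero_sub, conv]
  congr 1
  have h4 : ∫ σ, ext (oneK n) σ (ext h (θ - σ)) = ∫ σ in (-1 : ℝ)..0, ext h (θ - σ) := by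
    rw [← integral_lebesgueOn_eq, ← integral_indicator measurableSet_Icc]
    refine integral_congr_ae ?_
    filter_upwards [ext_congr (memLp_const (ContinuousLinearMap.id ℝ (Vec n)) :
      MemLp _ 2 (lebesgueOn (-1) 0)).coeFn_toLp] with σ hσ
    rw [oneK, hσ]
    by_cases hs : σ ∈ Set.Icc (-1 : ℝ) 0
    · rw [ext_of_mem hs, Set.indicator_of_mem hs]; rfl
    · rw [ext_of_notMem hs, Set.indicator_of_notMem hs]; rfl
  have hi : ∀ a b, IntervalIntegrable (ext h) volume a b := fun _ _ =>
    (integrable_ext h).intervalIntegrable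
  rw [h4, intervalIntegral.integral_comp_sub_left (ext h), sub_zero,
    ← intervalIntegral.integral_add_adjacent_intervals (hi θ 0) (hi 0 (θ - -1)), eq_comm, add_eq_left]
  refine intervalIntegral.integral_zero_ae (Eventually.of_forall fun s hs => ext_of_notMem fun h => ?_)
  rw [Set.uIoc_of_le (by linarith [hθ.1])] at hs
  exact absurd hs.1 (not_lt.2 h.2)

/-- Dominated convergence: on `[-1, 0]` the weights are at most `1`, and they tend to `0` for `θ <
0`. -/
theorem tendsto_norm_mulExp {E : Type*} [NormedAddCommGroup E] [NormedSpace ℝ E]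
    (f : Lp E 2 (lebesgueOn (-1) 0)) :
    Tendsto (fun k : ℕ => ‖mulExp (k : ℝ) f‖) atTop (𝓝 0) := by
  have h1 : ∀ k : ℕ, ‖mulExp (k : ℝ) f‖ₑ
      = (∫⁻ θ, (‖Real.exp (k * θ) • f θ‖ₑ) ^ (2 : ℝ) ∂lebesgueOn (-1) 0) ^ (1 / 2 : ℝ) := fun k => by
    rw [Lp.enorm_def, eLpNorm_congr_ae (coeFn_mulExp _ _),
      eLpNorm_eq_lintegral_rpow_enorm_toReal (by norm_num) (by norm_num)]
    simp
  have h2 : Tendsto (fun k : ℕ => ∫⁻ θ, (‖Real.exp (k * θ) • f θ‖ₑ) ^ (2 : ℝ) ∂lebesgueOn (-1) 0)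
      atTop (𝓝 (∫⁻ _, 0 ∂lebesgueOn (-1) 0)) := by
    refine tendsto_lintegral_of_dominated_convergence' (fun θ => ‖f θ‖ₑ ^ (2 : ℝ)) ?_ ?_ ?_ ?_
    · intro k
      exact (memLp_exp_smul (k : ℝ) f).1.enorm.pow_const _
    · intro k
      filter_upwards [ae_restrict_mem measurableSet_Icc] with θ hθ
      gcongr
      rw [enorm_smul]
      have : ‖Real.exp (k * θ)‖ₑ ≤ 1 := by
        rw [Real.enorm_eq_ofReal (Real.exp_pos _).le, ENNReal.ofReal_le_one, Real.exp_le_one_iff]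
        exact mul_nonpos_of_nonneg_of_nonpos (by positivity) hθ.2
      calc _ ≤ 1 * ‖f θ‖ₑ := by gcongr
        _ = _ := one_mul _
    · have := eLpNorm_lt_top_iff_lintegral_rpow_enorm_lt_top (p := 2) (by norm_num) (by norm_num)
        |>.1 (Lp.memLp f).2
      simpa using this.ne
    · have h3 : ∀ᵐ s ∂lebesgueOn (-1) 0, s ∈ Set.Ioo (-1 : ℝ) 0 := by
        rw [lebesgueOn, ← restrict_Ioo_eq_restrict_Icc]
        exact ae_restrict_mem measurableSet_Ioo
      filter_upwards [h3] with θ hθ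
      have h4 : Tendsto (fun k : ℕ => Real.exp (k * θ) • f θ) atTop (𝓝 ((0 : ℝ) • f θ)) := by
        refine Tendsto.smul_const ?_ _
        refine Real.tendsto_exp_atBot.comp ?_
        exact tendsto_natCast_atTop_atTop.atTop_mul_const_of_neg hθ.2
      have h5 := (ENNReal.continuous_rpow_const (y := 2)).tendsto _ |>.comp h4.enorm
      simpa [Function.comp_def] using h5
  have h3 : Tendsto (fun k : ℕ => ‖mulExp (k : ℝ) f‖ₑ) atTop (𝓝 0) := by
    simp_rw [h1]
    have := (ENNReal.continuous_rpow_const (y := 1 / 2)).tendsto _ |>.comp h2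
    simpa [Function.comp_def] using this
  have h4 := (ENNReal.tendsto_toReal (by simp)).comp h3
  simpa [Function.comp_def] using h4

theorem mulExp_convK_histL_zero (c : ℝ) (B : Kernel n) (h : L2 (-1) 0 n) :
    mulExp c (convK B (histL (WithLp.toLp 2 (0, h))))
      = -convK (mulExp c B) (convK (mulExp c (oneK n)) (mulExp c h)) := by
  rw [mulExp_convK, histL_zero_eq, (mulExp c).map_neg, mulExp_convK, (convK _).map_neg]

/-- Volterra equations of the second kind are uniquely solvable. -/
theorem bijective_volterra (P Q : L2 (-1) 0 n →L[ℝ] L2 (-1) 0 n)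
    (hP : ∀ c h, mulExp c (P h) = P (mulExp c h)) (hQ : ∀ c h, mulExp c (Q h) = Q (mulExp c h))
    (A B : Kernel n) :
    Function.Bijective fun h => h + (P (convK A h) + Q (convK B (histL (WithLp.toLp 2 (0, h))))) := by
  -- Conjugation with `e^{kθ}` commutes with `P` and `Q` and replaces the kernels by weighted ones,
  -- whose norms tend to `0`. For large `k` the operator becomes `1 + T` with `‖T‖ < 1`.
  have h1 : Tendsto (fun k : ℕ => ‖P‖ * ‖mulExp (k : ℝ) A‖
      + ‖Q‖ * (‖mulExp (k : ℝ) B‖ * ‖mulExp (k : ℝ) (oneK n)‖)) atTop (𝓝 0) := by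
    simpa using ((tendsto_norm_mulExp A).const_mul ‖P‖).add
      (((tendsto_norm_mulExp B).mul (tendsto_norm_mulExp (oneK n))).const_mul ‖Q‖)
  obtain ⟨k, hk⟩ := (h1.eventually (Iio_mem_nhds one_pos)).exists
  set c : ℝ := (k : ℝ)
  set T : L2 (-1) 0 n →L[ℝ] L2 (-1) 0 n := P.comp (convK (mulExp c A))
    - Q.comp ((convK (mulExp c B)).comp (convK (mulExp c (oneK n)))) with hT
  have hTn : ‖T‖ < 1 := by
    refine lt_of_le_of_lt ?_ hk
    refine (norm_sub_le _ _).trans (add_le_add ?_ ?_)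
    · exact (ContinuousLinearMap.opNorm_comp_le _ _).trans (by gcongr; exact norm_convK_le _)
    · refine (ContinuousLinearMap.opNorm_comp_le _ _).trans ?_
      gcongr
      exact (ContinuousLinearMap.opNorm_comp_le _ _).trans
        (mul_le_mul (norm_convK_le _) (norm_convK_le _) (norm_nonneg _) (norm_nonneg _))
  have hu : Function.Bijective ⇑(1 + T) := by
    rw [← ContinuousLinearMap.isUnit_iff_bijective]
    have := isUnit_one_sub_of_norm_lt_one (x := -T) (by rwa [norm_neg])
    rwa [sub_neg_eq_add] at this
  have hM : Function.Bijective (mulExp c : L2 (-1) 0 n →L[ℝ] L2 (-1) 0 n) := by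
    refine Function.bijective_iff_has_inverse.2 ⟨mulExp (-c), fun h => ?_, fun h =>
      mulExp_mulExp_neg c h⟩
    simpa using mulExp_mulExp_neg (-c) h
  have hconj : ∀ h, mulExp c (h + (P (convK A h) + Q (convK B (histL (WithLp.toLp 2 (0, h))))))
      = (1 + T) (mulExp c h) := by
    intro h
    rw [(mulExp c).map_add, (mulExp c).map_add, hP, hQ, mulExp_convK, mulExp_convK_histL_zero,
      Q.map_neg, ← sub_eq_add_neg]
    rfl
  have h2 : Function.Bijective (fun h => mulExp c
      (h + (P (convK A h) + Q (convK B (histL (WithLp.toLp 2 (0, h))))))) := by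
    simp_rw [hconj]
    exact hu.comp hM
  exact (Function.Bijective.of_comp_iff' hM _).1 h2

end Convolution

/-! ### The two duality maps: intertwining and bijectivity. -/

section Intertwining

variable {n : ℕ}

/-- The pointwise action of an operator on `L₂(-1, 0; ℝⁿ)`. -/
def pointwise (A : Vec n →L[ℝ] Vec n) : L2 (-1) 0 n →L[ℝ] L2 (-1) 0 n :=
  A.compLpL 2 (lebesgueOn (-1) 0)

theorem coeFn_pointwise (A : Vec n →L[ℝ] Vec n) (f : L2 (-1) 0 n) :
    pointwise A f =ᵐ[lebesgueOn (-1) 0] fun θ => A (f θ) :=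
  ContinuousLinearMap.coeFn_compLpL _ _

theorem mulExp_pointwise (c : ℝ) (A : Vec n →L[ℝ] Vec n) (f : L2 (-1) 0 n) :
    mulExp c (pointwise A f) = pointwise A (mulExp c f) := by
  refine Lp.ext ?_
  filter_upwards [coeFn_mulExp c (pointwise A f), coeFn_pointwise A f,
    coeFn_pointwise A (mulExp c f), coeFn_mulExp c f] with θ h1 h2 h3 h4
  rw [h1, h2, h3, h4, map_smul]

theorem pointwise_pointwise {A B : Vec n →L[ℝ] Vec n} (h : ∀ v, A (B v) = v)
    (f : L2 (-1) 0 n) : pointwise A (pointwise B f) = f := by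
  refine Lp.ext ?_
  filter_upwards [coeFn_pointwise A (pointwise B f), coeFn_pointwise B f] with θ h1 h2
  rw [h1, h2, h]

theorem hist_pointwise (A : Vec n →L[ℝ] Vec n) (e : M2 n) (θ : ℝ) :
    hist (WithLp.toLp 2 (A e.fst, pointwise A e.snd)) θ = A (hist e θ) := by
  have h1 : ∫ s in (0 : ℝ)..θ, ext (pointwise A e.snd) s = ∫ s in (0 : ℝ)..θ, A (ext e.snd s) := by
    refine intervalIntegral.integral_congr_ae ?_
    filter_upwards [ext_congr (coeFn_pointwise A e.snd)] with s hs _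
    rw [hs]
    by_cases h : s ∈ Set.Icc (-1 : ℝ) 0
    · rw [ext_of_mem h, ext_of_mem h]
    · rw [ext_of_notMem h, ext_of_notMem h, map_zero]
  change A e.fst + ∫ s in (0 : ℝ)..θ, ext (pointwise A e.snd) s = _
  rw [h1, A.intervalIntegral_comp_comm (integrable_ext e.snd).intervalIntegrable, ← map_add, hist]

theorem pointwise_histL (A : Vec n →L[ℝ] Vec n) (e : M2 n) :
    pointwise A (histL e) = histL (WithLp.toLp 2 (A e.fst, pointwise A e.snd)) := by
  refine Lp.ext ?_
  filter_upwards [coeFn_pointwise A (histL e), coeFn_histL e,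
    coeFn_histL (WithLp.toLp 2 (A e.fst, pointwise A e.snd))] with θ h1 h2 h3
  rw [h1, h2, h3, hist_pointwise]

theorem reverse_fst (e : M2 n) : (reverse e).fst = hist e (-1) := rfl

theorem reverse_snd (e : M2 n) : (reverse e).snd = -reflect e.snd := rfl

theorem reverse_reverse (e : M2 n) : reverse (reverse e) = e := by
  refine M2_ext ?_ ?_
  · change hist (reverse e) (-1) = e.fst
    rw [hist_reverse, sub_self, hist_zero]
  · change -reflect (-reflect e.snd) = e.snd
    rw [map_neg, neg_neg, reflect_reflect]

/-- The criterion for the duality relation of an operator `e ↦ (v, s)`. -/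
theorem inner_action_eq_inner_embed {A₁ A₁' : Vec n →L[ℝ] Vec n} {A₂ A₃ A₂' A₃' : Kernel n}
    (h₁ : ∀ v w, ⟪A₁' v, w⟫ = ⟪v, A₁ w⟫)
    (h₂ : ∀ᵐ θ ∂lebesgueOn (-1) 0, ∀ v w, ⟪A₂' θ v, w⟫ = ⟪v, A₂ θ w⟫)
    (h₃ : ∀ᵐ θ ∂lebesgueOn (-1) 0, ∀ v w, ⟪A₃' θ v, w⟫ = ⟪v, A₃ θ w⟫)
    {x x₁ : M2 n} (r : M2 n) (hx : x.snd = histL r - mulK A₂ x.fst) (hr : r.fst = x₁.fst)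
    (hr' : hist r (-1) = A₁ x₁.fst) (hs : r.snd = mulK A₃ x.fst - x₁.snd) (e' : M2 n) :
    ⟪action A₂' A₃' e', x⟫ = ⟪embed A₁' e', x₁⟫ := by
  have h := inner_snd_histL_add r e'
  rw [hr, hr', hs, inner_sub_right] at h
  rw [WithLp.prod_inner_apply, WithLp.prod_inner_apply]
  change ⟪intK A₂' e'.snd + intK A₃' (histL e'), x.fst⟫ + ⟪e'.snd, x.snd⟫
    = ⟪e'.fst - A₁' (hist e' (-1)), x₁.fst⟫ + ⟪histL e', x₁.snd⟫
  rw [hx, inner_add_left, inner_sub_left, inner_sub_right, inner_intK h₂, inner_intK h₃, h₁]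
  linarith

/-- The duality map for the output `C z(t - 1)`. -/
def dualPrev (A₂ A₃ : Kernel n) : M2 n →L[ℝ] M2 n :=
  pairL (evalL (-1)) (reflect.comp sndM - (convK A₂).comp (reflect.comp sndM)
    - (convK A₃).comp (reflect.comp histL) - (mulK A₂).comp (evalL (-1)))

theorem dualPrev_fst (A₂ A₃ : Kernel n) (e : M2 n) : (dualPrev A₂ A₃ e).fst = hist e (-1) := rfl

theorem dualPrev_snd (A₂ A₃ : Kernel n) (e : M2 n) : (dualPrev A₂ A₃ e).snd =
    reflect e.snd - convK A₂ (reflect e.snd) - convK A₃ (reflect (histL e))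
      - mulK A₂ (hist e (-1)) := rfl

/-- The duality map for the output `C z(t)`. -/
def dualCurrent (A₁ : Vec n →L[ℝ] Vec n) (A₂ A₃ : Kernel n) : M2 n →L[ℝ] M2 n :=
  pairL fstM (reflect.comp ((pointwise A₁).comp sndM + (convK (reflect A₂)).comp sndM
    + (convK (reflect A₃)).comp histL) - (mulK A₂).comp fstM)

theorem dualCurrent_fst (A₁ : Vec n →L[ℝ] Vec n) (A₂ A₃ : Kernel n) (e : M2 n) :
    (dualCurrent A₁ A₂ A₃ e).fst = e.fst := rfl

theorem dualCurrent_snd (A₁ : Vec n →L[ℝ] Vec n) (A₂ A₃ : Kernel n) (e : M2 n) :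
    (dualCurrent A₁ A₂ A₃ e).snd = reflect (pointwise A₁ e.snd + convK (reflect A₂) e.snd
      + convK (reflect A₃) (histL e)) - mulK A₂ e.fst := rfl

/-- Let `φ`, `φ₁` be the histories of `e`, `e₁`, so `φ' = φ₁`, and let `~` denote time reversal. The
witness is `r = φ₁~ - A₂ ∗ φ₁~ - A₃ ∗ φ~`. The convolutions vanish at `0` and equal `∫ A₂ φ₁` and `∫
A₃ φ` at `-1`, so `r(-1) = A₁ φ₁(-1)` is the first component of the hypothesis. -/
theorem inner_dualPrev {A₁ A₁' : Vec n →L[ℝ] Vec n} {A₂ A₃ A₂' A₃' : Kernel n}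
    (h₁ : ∀ v w, ⟪A₁' v, w⟫ = ⟪v, A₁ w⟫)
    (h₂ : ∀ᵐ θ ∂lebesgueOn (-1) 0, ∀ v w, ⟪A₂' θ v, w⟫ = ⟪v, A₂ θ w⟫)
    (h₃ : ∀ᵐ θ ∂lebesgueOn (-1) 0, ∀ v w, ⟪A₃' θ v, w⟫ = ⟪v, A₃ θ w⟫)
    {e e₁ : M2 n} (h : action A₂ A₃ e = embed A₁ e₁) (e' : M2 n) :
    ⟪action A₂' A₃' e', dualPrev A₂ A₃ e⟫ = ⟪embed A₁' e', dualPrev A₂ A₃ e₁⟫ := by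
  have hs : e.snd = histL e₁ := congrArg WithLp.snd h
  have hf : intK A₂ e.snd + intK A₃ (histL e) = e₁.fst - A₁ (hist e₁ (-1)) := congrArg WithLp.fst h
  have ha := hist_convK_neg_one A₂ (reverse e₁)
  have hb := hist_convK_neg_one A₃ (reverse e)
  rw [← reflect_histL, reflect_reflect] at ha hb
  rw [hs] at hf
  refine inner_action_eq_inner_embed h₁ h₂ h₃ (x := dualPrev A₂ A₃ e) (x₁ := dualPrev A₂ A₃ e₁)
    (reverse e₁
      + (-1 : ℝ) • WithLp.toLp 2 (0, convK A₂ (reverse e₁).snd - mulK A₂ (reverse e₁).fst)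
      + (-1 : ℝ) • WithLp.toLp 2 (0, convK A₃ (reverse e).snd - mulK A₃ (reverse e).fst))
    ?_ ?_ ?_ ?_ e'
  · rw [map_add histL, map_add histL, map_smul histL, map_smul histL, ← convK_histL, ← convK_histL,
      ← reflect_histL, ← reflect_histL, dualPrev_snd, dualPrev_fst, hs, neg_one_smul, neg_one_smul]
    abel
  · simp only [reverse_fst, dualPrev_fst, WithLp.add_fst, WithLp.smul_fst, WithLp.toLp_fst,
      smul_zero, add_zero]
  · rw [hist_add, hist_add, hist_smul, hist_smul, ha, hb, hist_reverse, sub_self, hist_zero,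
      dualPrev_fst, neg_one_smul, neg_one_smul, ← sub_eq_iff_eq_add'.2 (sub_eq_iff_eq_add.1 hf.symm)]
    abel
  · simp only [WithLp.add_snd, WithLp.smul_snd, WithLp.toLp_snd, dualPrev_snd, dualPrev_fst,
      reverse_snd, reverse_fst, map_neg, hs]
    simp only [neg_smul, one_smul]
    abel

/-- With `φ' = φ₁` as histories of `e` and `e₁`, and `~` for time reversal, `r` is the reversal of
`q = A₁ φ₁ + A₂~ ∗ φ₁ + A₃~ ∗ φ`. The convolutions vanish at `0`, so `q(0) = A₁ φ₁(0)`, while `q(-1)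
= A₁ φ₁(-1) + ∫ A₂ φ₁ + ∫ A₃ φ = φ₁(0)` by the hypothesis. -/
theorem inner_dualCurrent {A₁ A₁' : Vec n →L[ℝ] Vec n} {A₂ A₃ A₂' A₃' : Kernel n}
    (h₁ : ∀ v w, ⟪A₁' v, w⟫ = ⟪v, A₁ w⟫)
    (h₂ : ∀ᵐ θ ∂lebesgueOn (-1) 0, ∀ v w, ⟪A₂' θ v, w⟫ = ⟪v, A₂ θ w⟫)
    (h₃ : ∀ᵐ θ ∂lebesgueOn (-1) 0, ∀ v w, ⟪A₃' θ v, w⟫ = ⟪v, A₃ θ w⟫)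
    {e e₁ : M2 n} (h : action A₂ A₃ e = embed A₁ e₁) (e' : M2 n) :
    ⟪action A₂' A₃' e', dualCurrent A₁ A₂ A₃ e⟫ = ⟪embed A₁' e', dualCurrent A₁ A₂ A₃ e₁⟫ := by
  have hs : e.snd = histL e₁ := congrArg WithLp.snd h
  have hf : intK A₂ e.snd + intK A₃ (histL e) = e₁.fst - A₁ (hist e₁ (-1)) := congrArg WithLp.fst h
  rw [hs] at hf
  set q : M2 n := WithLp.toLp 2 (A₁ e₁.fst, pointwise A₁ e₁.snd)
    + WithLp.toLp 2 (0, convK (reflect A₂) e₁.snd - mulK (reflect A₂) e₁.fst)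
    + WithLp.toLp 2 (0, convK (reflect A₃) e.snd - mulK (reflect A₃) e.fst) with hq
  have hq0 : q.fst = A₁ e₁.fst := by simp [hq]
  have hq1 : hist q (-1) = e₁.fst := by
    rw [hq, hist_add, hist_add, hist_pointwise, hist_convK_neg_one, hist_convK_neg_one, intK_reflect,
      intK_reflect, reflect_reflect, reflect_reflect, add_assoc, hf]
    abel
  refine inner_action_eq_inner_embed h₁ h₂ h₃ (x := dualCurrent A₁ A₂ A₃ e)
    (x₁ := dualCurrent A₁ A₂ A₃ e₁) (reverse q) ?_ hq1 ?_ ?_ e'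
  · rw [← reflect_histL, hq, map_add histL, map_add histL, ← convK_histL, ← convK_histL,
      ← pointwise_histL, dualCurrent_fst, dualCurrent_snd, hs]
  · rw [hist_reverse, sub_self, hist_zero, hq0]; rfl
  · simp only [reverse_snd, hq, WithLp.add_snd, WithLp.toLp_snd, dualCurrent_fst, dualCurrent_snd,
      hs, map_add, map_sub, reflect_mulK, reflect_reflect]
    abel

theorem toLp_eq_sub (b : Vec n) (h : L2 (-1) 0 n) : (WithLp.toLp 2 (b, -h) : M2 n)
    = WithLp.toLp 2 (b, 0) - WithLp.toLp 2 (0, h) :=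
  M2_ext (by simp) (by simp)

theorem toLp_eq_add (b : Vec n) (h : L2 (-1) 0 n) : (WithLp.toLp 2 (b, h) : M2 n)
    = WithLp.toLp 2 (b, 0) + WithLp.toLp 2 (0, h) :=
  M2_ext (by simp) (by simp)

/-- In the unknowns `b = φ(-1)` and `h`, the reflection of `φ'`, the first component is `b` and the
second is a Volterra operator of the second kind in `h` plus terms in `b` alone. -/
theorem bijective_dualPrev (A₂ A₃ : Kernel n) : Function.Bijective (dualPrev A₂ A₃) := by
  have hv : Function.Bijective fun h =>
      h + (-convK A₂ h + convK A₃ (histL (WithLp.toLp 2 (0, h)))) :=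
    bijective_volterra (-ContinuousLinearMap.id ℝ _) (ContinuousLinearMap.id ℝ _)
      (fun c h => by simp) (fun c h => by simp) A₂ A₃
  have hfst : ∀ b h, (dualPrev A₂ A₃ (reverse (WithLp.toLp 2 (b, -h)))).fst = b := fun b h => by
    rw [dualPrev_fst, hist_reverse, sub_self, hist_zero, WithLp.toLp_fst]
  have hsnd : ∀ b h, (dualPrev A₂ A₃ (reverse (WithLp.toLp 2 (b, -h)))).snd
      = h + (-convK A₂ h + convK A₃ (histL (WithLp.toLp 2 (0, h))))
        - convK A₃ (histL (WithLp.toLp 2 (b, 0))) - mulK A₂ b := fun b h => by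
    rw [dualPrev_snd, ← dualPrev_fst A₂ A₃, hfst, reflect_histL, reverse_reverse, reverse_snd,
      WithLp.toLp_snd, map_neg, reflect_reflect, neg_neg, toLp_eq_sub, map_sub histL,
      map_sub (convK A₃)]
    abel
  constructor
  · refine (injective_iff_map_eq_zero _).2 fun e he => ?_
    obtain ⟨b, h, hr⟩ : ∃ b h, e = reverse (WithLp.toLp 2 (b, -h)) := by
      refine ⟨(reverse e).fst, -(reverse e).snd, ?_⟩
      rw [neg_neg]
      exact (reverse_reverse e).symm
    have hb := hfst b h
    have hh := hsnd b h
    have h0 : (WithLp.toLp 2 ((0 : Vec n), (0 : L2 (-1) 0 n)) : M2 n) = 0 := rfl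
    rw [← hr, he, WithLp.zero_fst] at hb
    rw [← hr, he, WithLp.zero_snd, ← hb, h0, map_zero, map_zero, map_zero, sub_zero, sub_zero] at hh
    have h1 : h = 0 := hv.1 (by simp only [← hh, h0, map_zero, neg_zero, add_zero])
    refine eq_zero_of_histL_eq_zero ?_
    rw [← reflect_reflect (histL e), reflect_histL, hr, reverse_reverse, h1, ← hb, neg_zero, h0,
      map_zero, map_zero]
  · intro x
    obtain ⟨h, hh⟩ := hv.2 (x.snd + mulK A₂ x.fst + convK A₃ (histL (WithLp.toLp 2 (x.fst, 0))))
    simp only at hh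
    refine ⟨reverse (WithLp.toLp 2 (x.fst, -h)), M2_ext (hfst _ _) ?_⟩
    rw [hsnd, hh]
    abel

theorem dualCurrent_toLp_snd {A₁ B₁ : Vec n →L[ℝ] Vec n} (hAB : ∀ v, A₁ (B₁ v) = v)
    (A₂ A₃ : Kernel n) (a : Vec n) (g : L2 (-1) 0 n) :
    (dualCurrent A₁ A₂ A₃ (WithLp.toLp 2 (a, g))).snd
      = reflect (pointwise A₁ (g + (pointwise B₁ (convK (reflect A₂) g)
        + pointwise B₁ (convK (reflect A₃) (histL (WithLp.toLp 2 (0, g))))))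
        + convK (reflect A₃) (histL (WithLp.toLp 2 (a, 0)))) - mulK A₂ a := by
  have hA : ∀ f, pointwise A₁ (pointwise B₁ f) = f := pointwise_pointwise hAB
  rw [dualCurrent_snd, WithLp.toLp_fst, WithLp.toLp_snd, toLp_eq_add a g, map_add histL,
    map_add (pointwise A₁), map_add (pointwise A₁), hA (convK (reflect A₂) g), hA,
    map_add (convK _)]
  congr 2
  abel

/-- The system is triangular in `(φ(0), φ')`. Its diagonal part in `φ'` is `A₁` times a Volterra
operator of the second kind, so invertibility of `A₁` enters here. -/
theorem bijective_dualCurrent {A₁ B₁ : Vec n →L[ℝ] Vec n} (hAB : ∀ v, A₁ (B₁ v) = v)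
    (hBA : ∀ v, B₁ (A₁ v) = v) (A₂ A₃ : Kernel n) :
    Function.Bijective (dualCurrent A₁ A₂ A₃) := by
  have hv := bijective_volterra (pointwise B₁) (pointwise B₁) (fun c h => mulExp_pointwise c B₁ h)
    (fun c h => mulExp_pointwise c B₁ h) (reflect A₂) (reflect A₃)
  have hB : ∀ f, pointwise B₁ (pointwise A₁ f) = f := pointwise_pointwise hBA
  have hsnd := dualCurrent_toLp_snd hAB A₂ A₃
  constructor
  · refine (injective_iff_map_eq_zero _).2 fun e he => ?_
    obtain ⟨a, g, hr⟩ : ∃ a g, e = WithLp.toLp 2 (a, g) := ⟨e.fst, e.snd, rfl⟩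
    have ha : a = 0 := by
      have := dualCurrent_fst A₁ A₂ A₃ e
      rwa [he, hr, WithLp.zero_fst, eq_comm] at this
    have h0 : (WithLp.toLp 2 ((0 : Vec n), (0 : L2 (-1) 0 n)) : M2 n) = 0 := rfl
    have hh := hsnd a g
    rw [← hr, he, WithLp.zero_snd, ha, h0] at hh
    simp only [map_zero, sub_zero, add_zero] at hh
    have hz : ∀ f, 0 = reflect (pointwise A₁ f) → f = 0 := fun f hf => by
      rw [← hB f, ← reflect_reflect (pointwise A₁ f), ← hf, map_zero reflect,
        map_zero (pointwise B₁)]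
    have h2 : g = 0 := hv.1 (by
      simp only [hz _ hh, h0, map_zero, add_zero])
    rw [hr, ha, h2, h0]
  · intro x
    obtain ⟨y, hy⟩ : ∃ y, y = reflect (x.snd + mulK A₂ x.fst)
      - convK (reflect A₃) (histL (WithLp.toLp 2 (x.fst, 0))) := ⟨_, rfl⟩
    obtain ⟨g, hg⟩ := hv.2 (pointwise B₁ y)
    simp only at hg
    refine ⟨WithLp.toLp 2 (x.fst, g), M2_ext rfl ?_⟩
    rw [hsnd, hg, pointwise_pointwise hAB y, hy, sub_add_cancel, reflect_reflect, add_sub_cancel_right]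

end Intertwining

/-! ### From matrix functions to kernels; the graph and the domain in coordinates. -/

section Matrices

variable {m n : ℕ}

/-- The operator given by a matrix. -/
def actL : Matrix (Fin m) (Fin n) ℝ →ₗ[ℝ] (Vec n →L[ℝ] Vec m) :=
  LinearMap.toContinuousLinearMap.toLinearMap ∘ₗ Matrix.toEuclideanLin.toLinearMap

theorem actL_apply (A : Matrix (Fin m) (Fin n) ℝ) (v : Vec n) : actL A v = act A v := rfl

theorem inner_act_transpose (A : Matrix (Fin m) (Fin n) ℝ) (v : Vec m) (w : Vec n) :
    ⟪act A.transpose v, w⟫ = ⟪v, act A w⟫ := by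
  rw [act, ← Matrix.conjTranspose_eq_transpose_of_trivial,
    Matrix.toEuclideanLin_conjTranspose_eq_adjoint, LinearMap.adjoint_inner_left]

theorem memLp_of_entries {E : Type*} [NormedAddCommGroup E] [NormedSpace ℝ E]
    (Φ : Matrix (Fin m) (Fin n) ℝ →ₗ[ℝ] E) {A : ℝ → Matrix (Fin m) (Fin n) ℝ} {μ : Measure ℝ}
    (hA : ∀ i j, MemLp (fun θ => A θ i j) 2 μ) : MemLp (fun θ => Φ (A θ)) 2 μ := by
  have h : (fun θ => Φ (A θ)) = fun θ => ∑ i, ∑ j, A θ i j • Φ (Matrix.single i j (1 : ℝ)) := by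
    funext θ
    conv_lhs => rw [Matrix.matrix_eq_sum_single (A θ)]
    simp only [map_sum]
    refine Finset.sum_congr rfl fun i _ => Finset.sum_congr rfl fun j _ => ?_
    rw [← map_smul, Matrix.smul_single, smul_eq_mul, mul_one]
  have h1 : ∀ (f : ℝ → ℝ) (v : E), MemLp f 2 μ → MemLp (fun θ => f θ • v) 2 μ := fun f v hf =>
    (ContinuousLinearMap.toSpanSingleton ℝ v).comp_memLp' hf
  rw [h]
  exact memLp_finsetSum _ fun i _ => memLp_finsetSum _ fun j _ => h1 _ _ (hA i j)

theorem memLp_actL {A : ℝ → Matrix (Fin m) (Fin n) ℝ}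
    (hA : ∀ i j, MemLp (fun θ => A θ i j) 2 (lebesgueOn (-1) 0)) :
    MemLp (fun θ => actL (A θ)) 2 (lebesgueOn (-1) 0) :=
  memLp_of_entries actL hA

theorem inner_kernel_transpose {A : ℝ → Matrix (Fin n) (Fin n) ℝ}
    (h : MemLp (fun θ => actL (A θ)) 2 (lebesgueOn (-1) 0))
    (h' : MemLp (fun θ => actL (A θ).transpose) 2 (lebesgueOn (-1) 0)) :
    ∀ᵐ θ ∂lebesgueOn (-1) 0, ∀ v w, ⟪(h'.toLp : Kernel n) θ v, w⟫ = ⟪v, (h.toLp : Kernel n) θ w⟫ := by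
  filter_upwards [h.coeFn_toLp, h'.coeFn_toLp] with θ h1 h2 v w
  rw [h1, h2]
  exact inner_act_transpose (A θ) v w

theorem pointValue_histL (e : M2 n) {θ : ℝ} (hθ : θ ∈ Set.Icc (-1 : ℝ) 0) :
    pointValue (histL e) θ = hist e θ :=
  pointValue_eq (isH1_hist e) (coeFn_histL e) hθ

theorem delayOp_eq {A₂ A₃ : ℝ → Matrix (Fin n) (Fin n) ℝ}
    (h₂ : MemLp (fun θ => actL (A₂ θ)) 2 (lebesgueOn (-1) 0))
    (h₃ : MemLp (fun θ => actL (A₃ θ)) 2 (lebesgueOn (-1) 0)) {φ : ℝ → Vec n} {g f : L2 (-1) 0 n}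
    (hf : f =ᵐ[lebesgueOn (-1) 0] φ) :
    delayOp A₂ A₃ φ g = intK h₂.toLp g + intK h₃.toLp f := by
  rw [intK_apply, intK_apply, ← integral_add (integrable_kernel_apply _ _)
    (integrable_kernel_apply _ _), delayOp]
  refine integral_congr_ae ?_
  filter_upwards [hf, h₂.coeFn_toLp, h₃.coeFn_toLp] with θ h1 h2 h3
  rw [h1, h2, h3]
  rfl

theorem generatorGraph_eq (A₁ : Matrix (Fin n) (Fin n) ℝ) {A₂ A₃ : ℝ → Matrix (Fin n) (Fin n) ℝ}
    (h₂ : MemLp (fun θ => actL (A₂ θ)) 2 (lebesgueOn (-1) 0))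
    (h₃ : MemLp (fun θ => actL (A₃ θ)) 2 (lebesgueOn (-1) 0)) :
    generatorGraph A₁ A₂ A₃
      = Set.range fun e => (embed (actL A₁) e, action h₂.toLp h₃.toLp e) := by
  ext ⟨x, y⟩
  constructor
  · rintro ⟨φ, g, hφ, hx, hv, hy⟩
    simp only at hx hv hy
    have h0 : x.snd = histL (WithLp.toLp 2 (φ 0, g)) := by
      refine Lp.ext ?_
      filter_upwards [hx, coeFn_histL (WithLp.toLp 2 (φ 0, g)),
        ae_restrict_mem measurableSet_Icc] with θ h1 h2 h3
      rw [h1, h2, hφ.eq_hist h3]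
    refine ⟨WithLp.toLp 2 (φ 0, g), Prod.ext (M2_ext ?_ h0.symm) (M2_ext ?_ ?_)⟩
    · rw [hv, hφ.eq_hist (by simp : (-1 : ℝ) ∈ Set.Icc (-1 : ℝ) 0)]
      rfl
    · rw [hy, WithLp.toLp_fst, delayOp_eq h₂ h₃ hx, h0]
      rfl
    · rw [hy]
      rfl
  · rintro ⟨e, he⟩
    obtain ⟨rfl, rfl⟩ := Prod.ext_iff.1 he
    refine ⟨hist e, e.snd, isH1_hist e, coeFn_histL e, ?_, ?_⟩
    · rw [hist_zero]
      rfl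
    · rw [delayOp_eq h₂ h₃ (coeFn_histL e)]
      rfl

theorem domain_eq (A₁ : Matrix (Fin n) (Fin n) ℝ) :
    domain A₁ = Set.range (embed (actL A₁)) := by
  -- The domain does not depend on the kernels, so it is read off from the graph with zero kernels.
  have h0 : ∀ i j : Fin n, MemLp (fun _ : ℝ => (0 : Matrix (Fin n) (Fin n) ℝ) i j) 2
    (lebesgueOn (-1) 0) := fun _ _ => memLp_const _
  have h := generatorGraph_eq A₁ (memLp_actL h0) (memLp_actL h0)
  have h1 : domain A₁ = Prod.fst '' generatorGraph A₁ (fun _ => 0) (fun _ => 0) := by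
    ext x
    constructor
    · rintro ⟨φ, g, hφ, hx, hv⟩
      exact ⟨(x, _), ⟨φ, g, hφ, hx, hv, rfl⟩, rfl⟩
    · rintro ⟨⟨x, y⟩, ⟨φ, g, hφ, hx, hv, -⟩, rfl⟩
      exact ⟨φ, g, hφ, hx, hv⟩
  rw [h1, h, ← Set.range_comp]
  rfl

end Matrices

/-! ### The input-to-state map and density of its range. -/

section Reachability

variable {X : Type*} [NormedAddCommGroup X] [InnerProductSpace ℝ X] [CompleteSpace X] {p : ℕ}

theorem integrable_orbit {S : ℝ → X →L[ℝ] X} (hS : IsC0Semigroup S) (F : Vec p →L[ℝ] X) {T : ℝ}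
    (u : L2 0 T p) : Integrable (fun t => S t (F (u t))) (lebesgueOn 0 T) := by
  obtain ⟨M, hM0, hM⟩ := hS.exists_bound T
  -- `S` is only strongly continuous, so measurability is obtained by expanding `u t` in the
  -- standard basis of `ℝᵖ`.
  have h : (fun t => S t (F (u t)))
      = fun t => ∑ i, (u t) i • S t (F (EuclideanSpace.single i 1)) := by
    funext t
    simp_rw [← map_smul, ← map_sum]
    congr 2
    ext j
    simp [Finset.sum_apply, Pi.single_apply]
  rw [h]
  refine integrable_finsetSum _ fun i _ => ?_
  have hu : Integrable (fun t => (u t) i) (lebesgueOn 0 T) :=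
    ((EuclideanSpace.proj i : Vec p →L[ℝ] ℝ).comp_memLp' (Lp.memLp u)).integrable (by norm_num)
  refine hu.smul_bdd (C := M * ‖F (EuclideanSpace.single i 1)‖) ?_ ?_
  · exact ((hS.continuousOn _).mono fun t ht => ht.1).aestronglyMeasurable measurableSet_Icc
  · filter_upwards [ae_restrict_mem measurableSet_Icc] with t ht
    exact (S t).le_of_opNorm_le (hM t ht) _

/-- The input-to-state map at time `T`. -/
def reach {S : ℝ → X →L[ℝ] X} (hS : IsC0Semigroup S) (F : Vec p →L[ℝ] X) (T : ℝ) :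
    L2 0 T p →ₗ[ℝ] X where
  toFun u := ∫ t in Set.Icc (0 : ℝ) T, S t (F (u t))
  map_add' u v := by
    rw [← integral_add (integrable_orbit hS F u) (integrable_orbit hS F v)]
    refine integral_congr_ae ?_
    filter_upwards [Lp.coeFn_add u v] with t ht
    rw [ht, Pi.add_apply, map_add, map_add]
  map_smul' c u := by
    rw [RingHom.id_apply, ← integral_smul]
    refine integral_congr_ae ?_
    filter_upwards [Lp.coeFn_smul c u] with t ht
    rw [ht, Pi.smul_apply, map_smul, map_smul]

theorem closure_range_eq_univ_iff {U : Type*} [AddCommGroup U] [Module ℝ U] (R : U →ₗ[ℝ] X) :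
    closure (Set.range R) = Set.univ ↔ ∀ w : X, (∀ u, ⟪R u, w⟫ = 0) → w = 0 := by
  have h1 : closure (Set.range R) = Set.univ ↔ (LinearMap.range R).topologicalClosure = ⊤ := by
    rw [← SetLike.coe_set_eq (p := (LinearMap.range R).topologicalClosure), Submodule.topologicalClosure_coe, LinearMap.coe_range,
      Submodule.top_coe]
  rw [h1, Submodule.topologicalClosure_eq_top_iff, Submodule.eq_bot_iff]
  refine forall_congr' fun w => ?_
  rw [Submodule.mem_orthogonal]
  simp

/-- Test with `u = k`, which is in `L₂` because it is continuous on a compact interval. -/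
theorem forall_integral_inner_eq_zero_iff {T : ℝ} {k : ℝ → Vec p}
    (hk : ContinuousOn k (Set.Icc 0 T)) :
    (∀ u : L2 0 T p, ∫ t in Set.Icc (0 : ℝ) T, ⟪u t, k t⟫ = 0)
      ↔ ∀ᵐ t ∂lebesgueOn 0 T, k t = 0 := by
  constructor
  · intro h
    obtain ⟨c, hc⟩ := isCompact_Icc.exists_bound_of_continuousOn hk
    have hm : MemLp k 2 (lebesgueOn 0 T) :=
      MemLp.of_bound (hk.aestronglyMeasurable measurableSet_Icc) c (by
        filter_upwards [ae_restrict_mem measurableSet_Icc] with t ht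
        exact hc t ht)
    have h1 : ⟪hm.toLp, hm.toLp⟫ = 0 := by
      refine Eq.trans ?_ (h hm.toLp)
      rw [L2.inner_def]
      refine integral_congr_ae ?_
      filter_upwards [hm.coeFn_toLp] with t ht
      rw [ht]
    have h2 := inner_self_eq_zero.1 h1
    filter_upwards [hm.coeFn_toLp, Lp.coeFn_zero (Vec p) 2 (lebesgueOn 0 T)] with t h3 h4
    rw [← h3, h2, h4, Pi.zero_apply]
  · intro h u
    refine integral_eq_zero_of_ae ?_
    filter_upwards [h] with t ht
    rw [ht, inner_zero_right, Pi.zero_apply]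

end Reachability

/-! ### Duality of observability and controllability. -/

section Duality

variable {n p : ℕ} {A₁ A₁' : Matrix (Fin n) (Fin n) ℝ} {A₂ A₃ A₂' A₃' : Kernel n}
  {S S' : ℝ → M2 n →L[ℝ] M2 n}

/-- The operator `l - 𝒜` in the coordinates `(φ(0), φ')` on `D(𝒜)`. -/
def resolventEquiv {A₁ : Vec n →L[ℝ] Vec n} {A₂ A₃ : Kernel n} {l : ℝ}
    (hl : Function.Bijective (l • embed A₁ - action A₂ A₃)) : M2 n ≃L[ℝ] M2 n :=
  ContinuousLinearEquiv.ofBijective (l • embed A₁ - action A₂ A₃)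
    (LinearMap.ker_eq_bot.2 hl.1) (LinearMap.range_eq_top.2 hl.2)

theorem resolventEquiv_apply {A₁ : Vec n →L[ℝ] Vec n} {A₂ A₃ : Kernel n} {l : ℝ}
    (hl : Function.Bijective (l • embed A₁ - action A₂ A₃)) (e : M2 n) :
    resolventEquiv hl e = l • embed A₁ e - action A₂ A₃ e := rfl

/-- Orbits stay in the graph, so on coordinates the evolution is the conjugate of `S t` by `l - 𝒜`.
Point values of the history are therefore continuous in `t`. -/
theorem apply_embed {A₁ : Vec n →L[ℝ] Vec n} {l : ℝ}
    (hl : Function.Bijective (l • embed A₁ - action A₂ A₃))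
    (hS : IsGeneratedBy S (Set.range fun e => (embed A₁ e, action A₂ A₃ e))) (e : M2 n) {t : ℝ}
    (ht : 0 ≤ t) :
    S t (embed A₁ e) = embed A₁ ((resolventEquiv hl).symm (S t (resolventEquiv hl e))) := by
  obtain ⟨e₂, he⟩ := hS.orbit_mem (Set.mem_range_self e) ht
  obtain ⟨h1, h2⟩ := Prod.ext_iff.1 he
  simp only at h1 h2
  rw [← h1]
  congr 1
  rw [ContinuousLinearEquiv.eq_symm_apply, resolventEquiv_apply, resolventEquiv_apply, map_sub,
    map_smul, h1, h2]

/-- `W` acts on coordinates of the domain only; composing it with `(l - 𝒜)⁻¹` yields a bounded form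
on `M₂`, to which the general intertwining applies. -/
theorem inner_semigroup {A₁ A₁' : Vec n →L[ℝ] Vec n} {l : ℝ}
    (hl : Function.Bijective (l • embed A₁ - action A₂ A₃))
    (hS : IsGeneratedBy S (Set.range fun e => (embed A₁ e, action A₂ A₃ e)))
    (hS' : IsGeneratedBy S' (Set.range fun e => (embed A₁' e, action A₂' A₃' e)))
    (hd : Dense (Set.range (embed A₁))) (hd' : Dense (Set.range (embed A₁')))
    (W : M2 n →L[ℝ] M2 n)
    (hW : ∀ e e₁, action A₂ A₃ e = embed A₁ e₁ → ∀ e',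
      ⟪action A₂' A₃' e', W e⟫ = ⟪embed A₁' e', W e₁⟫)
    (x x' : M2 n) {t : ℝ} (ht : 0 ≤ t) :
    ⟪S' t x', W ((resolventEquiv hl).symm x)⟫
      = ⟪x', W ((resolventEquiv hl).symm (S t x))⟫ := by
  set N := resolventEquiv hl with hN
  refine hS.intertwine hS' ((innerSL ℝ (E := M2 n)).bilinearComp (ContinuousLinearMap.id ℝ _)
    (W.comp N.symm.toContinuousLinearMap)) ?_ ?_ ?_ x x' ht
  · rintro x y x' y' ⟨f, hf⟩ ⟨e', he'⟩
    obtain ⟨rfl, rfl⟩ := Prod.ext_iff.1 hf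
    obtain ⟨rfl, rfl⟩ := Prod.ext_iff.1 he'
    have h1 : l • embed A₁ (N.symm (embed A₁ f)) - action A₂ A₃ (N.symm (embed A₁ f))
        = embed A₁ f := by
      rw [← resolventEquiv_apply hl, ← hN, ContinuousLinearEquiv.apply_symm_apply]
    -- The identity `𝒜 (l - 𝒜)⁻¹ = l (l - 𝒜)⁻¹ - 1` on the domain, in coordinates.
    have h2 : N.symm (action A₂ A₃ f) = l • N.symm (embed A₁ f) - f := by
      rw [ContinuousLinearEquiv.symm_apply_eq, map_sub, map_smul,
        ContinuousLinearEquiv.apply_symm_apply, hN, resolventEquiv_apply]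
      abel
    change ⟪action A₂' A₃' e', W (N.symm (embed A₁ f))⟫
      = ⟪embed A₁' e', W (N.symm (action A₂ A₃ f))⟫
    rw [h2]
    refine hW _ _ ?_ e'
    rw [map_sub, map_smul]
    exact eq_sub_of_add_eq' (sub_eq_iff_eq_add.1 h1).symm
  · rwa [← Set.range_comp]
  · rwa [← Set.range_comp]

/-- Inputs enter through the first component of `M₂`, and the first component of `W e` is the
observed value `φ(θ₀)`. Pairing the reachable set with `W e` therefore integrates `u` against the
output of `e`, and the range of `W` exhausts the test vectors. -/
theorem approxObservable_iff
    (hS : IsGeneratedBy S (Set.range fun e => (embed (actL A₁) e, action A₂ A₃ e)))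
    (hS' : IsGeneratedBy S' (Set.range fun e => (embed (actL A₁') e, action A₂' A₃' e)))
    (W : M2 n →L[ℝ] M2 n) (hWb : Function.Bijective W)
    (hW : ∀ e e₁, action A₂ A₃ e = embed (actL A₁) e₁ → ∀ e',
      ⟪action A₂' A₃' e', W e⟫ = ⟪embed (actL A₁') e', W e₁⟫)
    (C : Matrix (Fin p) (Fin n) ℝ) {θ₀ : ℝ} (hθ : θ₀ ∈ Set.Icc (-1 : ℝ) 0)
    (hW₀ : ∀ e, (W e).fst = hist e θ₀) (T : ℝ) :
    ApproxObservable A₁ S C θ₀ T ↔ ApproxControllable S' C.transpose T := by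
  obtain ⟨hd, -, l, hl⟩ := exists_isGeneratedBy (actL A₁) A₂ A₃
  obtain ⟨hd', -, -⟩ := exists_isGeneratedBy (actL A₁') A₂' A₃'
  set N := resolventEquiv hl with hN
  set k : M2 n → ℝ → Vec p := fun e t => act C (W (N.symm (S t (N e)))).fst with hk
  have hkc : ∀ e, ContinuousOn (k e) (Set.Icc 0 T) := fun e => by
    have h1 : Continuous fun x => actL C (fstM (W (N.symm x))) := by fun_prop
    exact h1.comp_continuousOn ((hS.1.continuousOn (N e)).mono fun t ht => ht.1)
  have hout : ∀ e, ∀ t ∈ Set.Icc 0 T, output C θ₀ (S t (embed (actL A₁) e)) = k e t := by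
    intro e t ht
    rw [apply_embed hl hS e ht.1, output, embed_apply, WithLp.toLp_snd, pointValue_histL _ hθ, ← hW₀]
  have hobs : ApproxObservable A₁ S C θ₀ T ↔ ∀ e, (∀ᵐ t ∂lebesgueOn 0 T, k e t = 0) → e = 0 := by
    have h1 : ∀ e, (embed (actL A₁) e ∈ outputKernel A₁ S C θ₀ T ↔
        ∀ᵐ t ∂lebesgueOn 0 T, k e t = 0) := by
      intro e
      rw [outputKernel, domain_eq, Set.mem_ofPred_eq, and_iff_right (Set.mem_range_self e)]
      refine eventually_congr ?_
      filter_upwards [ae_restrict_mem measurableSet_Icc] with t ht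
      rw [hout e t ht]
    constructor
    · intro h e he
      have h2 := (h1 e).2 he
      rw [h, Set.mem_singleton_iff] at h2
      exact (map_eq_zero_iff _ (embed_injective _)).1 h2
    · intro h
      refine Set.Subset.antisymm ?_ (Set.singleton_subset_iff.2 ?_)
      · intro x hx
        obtain ⟨e, rfl⟩ : x ∈ Set.range (embed (actL A₁)) := domain_eq A₁ ▸ hx.1
        rw [Set.mem_singleton_iff, h e ((h1 e).1 hx), map_zero]
      · rw [← map_zero (embed (actL A₁)), h1]
        refine Eventually.of_forall fun t => ?_
        simp [hk]
  set F : Vec p →L[ℝ] M2 n := pairL (actL C.transpose) 0 with hF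
  have hC : IsC0Semigroup S' := hS'.1
  have hreach : reachableSet S' C.transpose T = Set.range (reach hC F T) := rfl
  have hinner : ∀ e u, ⟪reach hC F T u, W e⟫ = ∫ t in Set.Icc (0 : ℝ) T, ⟪u t, k e t⟫ := by
    intro e u
    change ⟪∫ t in Set.Icc (0 : ℝ) T, S' t (F (u t)), W e⟫ = _
    rw [real_inner_comm, ← integral_inner (integrable_orbit hC F u)]
    refine setIntegral_congr_fun measurableSet_Icc fun t ht => ?_
    have h1 := inner_semigroup hl hS hS' hd hd' W hW (N e) (F (u t)) ht.1
    rw [← hN, ContinuousLinearEquiv.symm_apply_apply] at h1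
    change ⟪W e, S' t (F (u t))⟫ = ⟪u t, k e t⟫
    rw [real_inner_comm, h1, WithLp.prod_inner_apply]
    change ⟪act C.transpose (u t), _⟫ + ⟪(0 : L2 (-1) 0 n), _⟫ = _
    rw [inner_zero_left, add_zero, inner_act_transpose]
    rfl
  rw [hobs, ApproxControllable, hreach, closure_range_eq_univ_iff]
  refine Iff.trans (forall_congr' fun e => ?_) hWb.2.forall.symm
  have h1 : (∀ u, ⟪reach hC F T u, W e⟫ = 0) ↔ ∀ᵐ t ∂lebesgueOn 0 T, k e t = 0 := by
    rw [← forall_integral_inner_eq_zero_iff (hkc e)]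
    exact forall_congr' fun u => by rw [hinner]
  rw [h1, map_eq_zero_iff W hWb.1]

end Duality

end NeutralSystem

end

theorem mainTheorem8 (n p : ℕ)
    (A₁ : Matrix (Fin n) (Fin n) ℝ) (A₂ A₃ : ℝ → Matrix (Fin n) (Fin n) ℝ)
    (hA₂ : ∀ i j, MemLp (fun θ => A₂ θ i j) 2 (volume.restrict (Set.Icc (-1 : ℝ) 0)))
    (hA₃ : ∀ i j, MemLp (fun θ => A₃ θ i j) 2 (volume.restrict (Set.Icc (-1 : ℝ) 0)))
    (C : Matrix (Fin p) (Fin n) ℝ) (T : ℝ) (hT : 0 < T) :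
    -- the operators of the system and of the transposed system generate `C₀`-semigroups, and ...
    (∃ S, NeutralSystem.IsGeneratedBy S (NeutralSystem.generatorGraph A₁ A₂ A₃)) ∧
    (∃ S', NeutralSystem.IsGeneratedBy S'
      (NeutralSystem.generatorGraph A₁.transpose (fun θ => (A₂ θ).transpose)
        (fun θ => (A₃ θ).transpose))) ∧
    -- ... for these semigroups:
    ∀ S S' : ℝ → NeutralSystem.M2 n →L[ℝ] NeutralSystem.M2 n,
      NeutralSystem.IsGeneratedBy S (NeutralSystem.generatorGraph A₁ A₂ A₃) →
      NeutralSystem.IsGeneratedBy S'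
        (NeutralSystem.generatorGraph A₁.transpose (fun θ => (A₂ θ).transpose)
          (fun θ => (A₃ θ).transpose)) →
      (NeutralSystem.ApproxObservable A₁ S C (-1) T ↔
          NeutralSystem.ApproxControllable S' C.transpose T) ∧
      (A₁.det ≠ 0 →
        (NeutralSystem.ApproxObservable A₁ S C 0 T ↔
          NeutralSystem.ApproxControllable S' C.transpose T)) := by
  have h₂ := NeutralSystem.memLp_actL hA₂
  have h₃ := NeutralSystem.memLp_actL hA₃
  have h₂' := NeutralSystem.memLp_actL (A := fun θ => (A₂ θ).transpose) fun i j => hA₂ j i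
  have h₃' := NeutralSystem.memLp_actL (A := fun θ => (A₃ θ).transpose) fun i j => hA₃ j i
  have a₁ : ∀ v w, ⟪NeutralSystem.actL A₁.transpose v, w⟫ = ⟪v, NeutralSystem.actL A₁ w⟫ :=
    NeutralSystem.inner_act_transpose A₁
  have a₂ := NeutralSystem.inner_kernel_transpose h₂ h₂'
  have a₃ := NeutralSystem.inner_kernel_transpose h₃ h₃'
  rw [NeutralSystem.generatorGraph_eq A₁ h₂ h₃, NeutralSystem.generatorGraph_eq A₁.transpose h₂' h₃']
  refine ⟨(NeutralSystem.exists_isGeneratedBy _ _ _).2.1,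
    (NeutralSystem.exists_isGeneratedBy _ _ _).2.1, fun S S' hS hS' => ⟨?_, fun hdet => ?_⟩⟩
  · exact NeutralSystem.approxObservable_iff hS hS' (NeutralSystem.dualPrev h₂.toLp h₃.toLp)
      (NeutralSystem.bijective_dualPrev _ _)
      (fun e e₁ h e' => NeutralSystem.inner_dualPrev a₁ a₂ a₃ h e') C (by simp) (fun _ => rfl) T
  · have hu : IsUnit A₁.det := isUnit_iff_ne_zero.2 hdet
    have hAB : ∀ v, NeutralSystem.actL A₁ (NeutralSystem.actL A₁⁻¹ v) = v := fun v => by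
      simp [NeutralSystem.actL_apply, Matrix.toLpLin_apply, Matrix.mul_nonsing_inv _ hu]
    have hBA : ∀ v, NeutralSystem.actL A₁⁻¹ (NeutralSystem.actL A₁ v) = v := fun v => by
      simp [NeutralSystem.actL_apply, Matrix.toLpLin_apply, Matrix.nonsing_inv_mul _ hu]
    exact NeutralSystem.approxObservable_iff hS hS'
      (NeutralSystem.dualCurrent (NeutralSystem.actL A₁) h₂.toLp h₃.toLp)
      (NeutralSystem.bijective_dualCurrent hAB hBA _ _)
      (fun e e₁ h e' => NeutralSystem.inner_dualCurrent a₁ a₂ a₃ h e') C (by simp)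
      (fun e => (NeutralSystem.hist_zero e).symm) T
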